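/- Let $k$ be a positive even integer, and let $G$ be a finite simple graph with minimum degree at least $k+1$. Then $G$ contains cycles of all even lengths modulo $k$; that is, for every even integer $m$, $G$ contains a cycle whose length is congruent to $m$ modulo $k$. Furthermore, if $G$ is 2-connected (that is, $G$ is connected, has at least three vertices, and remains connected after the deletion of any single vertex) and non-bipartite, then $G$ contains cycles of all lengths modulo $k$; that is, for every integer $m$, $G$ contains a cycle whose length is congruent to $m$ modulo $k$. -/

import Mathlib

namespace SimpleGraph

/-- `G` has a cycle whose length is congruent to `m` modulo `k`. -/
def HasCycleLengthMod {V : Type*} (G : SimpleGraph V) (m k : ℕ) : Prop :=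
  ∃ (v : V) (c : G.Walk v v), c.IsCycle ∧ c.length ≡ m [MOD k]

/-- A finite graph is 2-connected if it is connected, has at least three vertices, and stays
connected after the deletion of any one vertex. -/
def IsTwoConnected {V : Type*} [Fintype V] (G : SimpleGraph V) : Prop :=
  3 ≤ Fintype.card V ∧ G.Connected ∧ ∀ v : V, (G.induce ({v}ᶜ : Set V)).Connected

end SimpleGraph

/-! Write k = 2l and take a maximum cut of G. Each vertex keeps at least half of its edges, so the
bipartite graph H of crossing edges has minimum degree at least l + 1. If the ends of an edge ab of
G are joined in H by paths of lengths N, N + 2, ..., N + 2(l - 1) with N ≥ 2, then ab closes them to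
cycles whose lengths cover all residues modulo 2l of one parity: even if ab crosses the cut, odd if
a and b have the same colour. A suitable crossing edge always exists. A monochromatic one exists if
G is not bipartite, and 2-connectedness together with maximality of the cut allows a suitable
choice.

The paths come from `Rooted.rootPaths`, proved by induction on the number of vertices. The one
exceptional vertex z of unrestricted degree makes the induction close, since a reduction may spoil
the degree of one vertex. A minimal counterexample has essentially no 2-separations
(`Minimal.three_le_bdry`). Take a complete bipartite subgraph with sides S ∋ x and T = `common G S`,
with |S| ≤ k as large as possible and then |T| as large as possible. Inside it x reaches each vertex
of T by |S| consecutive odd lengths, and each other vertex of S by |S| - 1 consecutive even lengths.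
These combine with a shorter progression, obtained by induction after contracting T or S∖{x} to a
root, into k lengths. Maximality bounds the degrees lost in the contraction.

Hence the component F of y outside S ∪ T must be too degenerate for the induction hypothesis
(`Stage.exists_residual`). If T has a neighbour in F, one vertex t₁ of T is set aside as the way to
y and the same analysis is applied beyond t₁; this is contradictory (`MaxCore.card_common_le`,
`MaxCore.not_touch`). Otherwise F = {y} and all neighbours of y lie in S, so deg y < |S| ≤ |T| ≤ deg
x; exchanging x and y gives the opposite inequality (`Minimal.false`). -/

namespace CycleLengths

open Finset

/-! ### Paths within vertex sets, connectivity by cuts, boundaries -/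

section Basics

open scoped Classical

universe u
variable {V : Type u}

/-- There is a path of length `n` from `a` to `b` all of whose vertices lie in `R`. -/
def Linked (G : SimpleGraph V) (R : Finset V) (a b : V) (n : ℕ) : Prop :=
  ∃ p : G.Walk a b, p.IsPath ∧ p.length = n ∧ ∀ v ∈ p.support, v ∈ R

/-- Some vertex of `A` is adjacent to some vertex of `C`. -/
def Touch (G : SimpleGraph V) (A C : Finset V) : Prop :=
  ∃ a ∈ A, ∃ c ∈ C, G.Adj a c

/-- Every vertex of `F` can be joined to `q` inside `F`, in terms of cuts. -/
def ConnTo (G : SimpleGraph V) (F : Finset V) (q : V) : Prop :=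
  q ∈ F ∧ ∀ C ⊆ F, C.Nonempty → q ∉ C → ∃ u ∈ C, ∃ v ∈ F, v ∉ C ∧ G.Adj u v

/-- The vertices outside `C` with a neighbour in `C`. -/
noncomputable def bdry [Fintype V] (G : SimpleGraph V) (C : Finset V) : Finset V :=
  univ.filter fun v => v ∉ C ∧ ∃ u ∈ C, G.Adj u v

/-- The neighbours of `v`. -/
noncomputable def nbr [Fintype V] (G : SimpleGraph V) (v : V) : Finset V :=
  univ.filter fun u => G.Adj v u

variable {G : SimpleGraph V}

theorem mem_bdry [Fintype V] {C : Finset V} {v : V} :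
    v ∈ bdry G C ↔ v ∉ C ∧ ∃ u ∈ C, G.Adj u v := by
  simp [bdry]

theorem mem_nbr [Fintype V] {u v : V} : u ∈ nbr G v ↔ G.Adj v u := by
  simp [nbr]

theorem bdry_singleton [Fintype V] (v : V) : bdry G {v} = nbr G v := by
  ext u
  simp only [mem_bdry, mem_nbr, mem_singleton, exists_eq_left]
  constructor
  · exact fun h => h.2
  · exact fun h => ⟨h.ne', h⟩

theorem Linked.mono {R R' : Finset V} {a b : V} {n : ℕ} (h : Linked G R a b n) (hR : R ⊆ R') :
    Linked G R' a b n := by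
  obtain ⟨p, h1, h2, h3⟩ := h
  exact ⟨p, h1, h2, fun v hv => hR (h3 v hv)⟩

theorem Linked.symm {R : Finset V} {a b : V} {n : ℕ} (h : Linked G R a b n) :
    Linked G R b a n := by
  obtain ⟨p, h1, h2, h3⟩ := h
  exact ⟨p.reverse, h1.reverse, by simpa using h2, fun v hv => h3 v (by simpa using hv)⟩

theorem Linked.left_mem {R : Finset V} {a b : V} {n : ℕ} (h : Linked G R a b n) : a ∈ R := by
  obtain ⟨p, -, -, h3⟩ := h
  exact h3 _ p.start_mem_support

theorem Linked.right_mem {R : Finset V} {a b : V} {n : ℕ} (h : Linked G R a b n) : b ∈ R :=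
  h.symm.left_mem

theorem Linked.refl {R : Finset V} {a : V} (h : a ∈ R) : Linked G R a a 0 :=
  ⟨.nil, by simp, rfl, by simpa using h⟩

theorem Linked.of_adj {R : Finset V} {a b : V} (h : G.Adj a b) (ha : a ∈ R) (hb : b ∈ R) :
    Linked G R a b 1 :=
  ⟨h.toWalk, by simp [SimpleGraph.Walk.isPath_def, h.ne], by simp, by simp [ha, hb]⟩

theorem Linked.append {R₁ R₂ R : Finset V} {a b c : V} {n m : ℕ} (h₁ : Linked G R₁ a b n)
    (h₂ : Linked G R₂ b c m) (hd : ∀ v ∈ R₁, v ∈ R₂ → v = b) (hR₁ : R₁ ⊆ R) (hR₂ : R₂ ⊆ R) :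
    Linked G R a c (n + m) := by
  obtain ⟨p, hp, hpn, hpR⟩ := h₁
  obtain ⟨q, hq, hqm, hqR⟩ := h₂
  refine ⟨p.append q, ?_, by simp [hpn, hqm], ?_⟩
  · rw [SimpleGraph.Walk.isPath_def, SimpleGraph.Walk.support_append, List.nodup_append']
    have hq' := hq.support_nodup
    rw [← SimpleGraph.Walk.cons_tail_support, List.nodup_cons] at hq'
    refine ⟨hp.support_nodup, hq'.2, fun v hv hv' => ?_⟩
    have := hd v (hpR v hv) (hqR v (List.mem_of_mem_tail hv'))
    exact hq'.1 (this ▸ hv')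
  · intro v hv
    rw [SimpleGraph.Walk.mem_support_append_iff] at hv
    exact hv.elim (fun h => hR₁ (hpR v h)) (fun h => hR₂ (hqR v h))

theorem Linked.of_walk {R : Finset V} {a b : V} (p : G.Walk a b) (h : ∀ v ∈ p.support, v ∈ R) :
    ∃ n, Linked G R a b n :=
  ⟨_, p.bypass, p.bypass_isPath, rfl, fun v hv => h v (p.support_bypass_subset_support hv)⟩

/-- The vertices of `F` with no path to `q` would form a set that no edge of `F` leaves. -/
theorem ConnTo.linked {F : Finset V} {q d : V} (h : ConnTo G F q) (hd : d ∈ F) :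
    ∃ n, Linked G F d q n := by
  by_contra hcon
  obtain ⟨u, hu, v, hvF, hv, huv⟩ := h.2 (F.filter fun d => ¬ ∃ n, Linked G F d q n)
    (filter_subset _ _) ⟨d, by simpa [hd] using hcon⟩ (by simpa [h.1] using ⟨0, Linked.refl h.1⟩)
  simp only [mem_filter, hvF, true_and, not_not] at hu hv
  obtain ⟨n, p, -, -, hp⟩ := hv
  refine hu.2 (Linked.of_walk (.cons huv p) ?_)
  intro w hw
  rw [SimpleGraph.Walk.support_cons, List.mem_cons] at hw
  exact hw.elim (fun h => h ▸ hu.1) (hp w)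

theorem exists_min_card {P : Finset V → Prop} (h : ∃ C, P C) :
    ∃ C, P C ∧ ∀ C', P C' → #C ≤ #C' := by
  have h' : ∃ n, ∃ C, P C ∧ #C = n := by obtain ⟨C, hC⟩ := h; exact ⟨_, C, hC, rfl⟩
  obtain ⟨C, hC, hn⟩ := Nat.find_spec h'
  exact ⟨C, hC, fun C' hC' => hn ▸ Nat.find_min' h' ⟨C', hC', rfl⟩⟩

theorem exists_max_card [Fintype V] {P : Finset V → Prop} (h : ∃ C, P C) :
    ∃ C, P C ∧ ∀ C', P C' → #C' ≤ #C := by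
  obtain ⟨C₀, hC₀⟩ := h
  obtain ⟨C, hC, hmax⟩ := exists_max_image (univ.filter P) card ⟨C₀, by simpa using hC₀⟩
  simp only [mem_filter, mem_univ, true_and] at hC hmax
  exact ⟨C, hC, hmax⟩

/-- A smallest subset of `W` that contains `q` and is closed under adjacency in `W` is connected to
`q`: a part that no edge leaves could be removed. -/
theorem exists_component (G : SimpleGraph V) {W : Finset V} {q : V} (hq : q ∈ W) :
    ∃ F ⊆ W, ConnTo G F q ∧ ∀ u ∈ F, ∀ v ∈ W, G.Adj u v → v ∈ F := by
  obtain ⟨F, ⟨hFW, hqF, hcl⟩, hmin⟩ := exists_min_card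
    (P := fun F => F ⊆ W ∧ q ∈ F ∧ ∀ u ∈ F, ∀ v ∈ W, G.Adj u v → v ∈ F)
    ⟨W, Subset.refl _, hq, fun _ _ v hv _ => hv⟩
  refine ⟨F, hFW, ⟨hqF, fun C hCF hC hqC => ?_⟩, hcl⟩
  by_contra! hcon
  have := hmin (F \ C) ⟨sdiff_subset.trans hFW, by simp [hqF, hqC], fun u hu v hv huv => ?_⟩
  · have h1 : #(F \ C) < #F := card_lt_card (sdiff_ssubset hCF hC)
    omega
  · rw [mem_sdiff] at hu ⊢
    have hvF := hcl u hu.1 v hv huv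
    exact ⟨hvF, fun hvC => hcon v hvC u hu.1 hu.2 huv.symm⟩

theorem ConnTo.subset_of_closed {F F' W : Finset V} {q : V} (h : ConnTo G F q) (hFW : F ⊆ W)
    (hq : q ∈ F') (hcl : ∀ u ∈ F', ∀ v ∈ W, G.Adj u v → v ∈ F') : F ⊆ F' := by
  by_contra hcon
  obtain ⟨u, hu, v, hvF, hv, huv⟩ := h.2 (F \ F') sdiff_subset
    (by rwa [sdiff_nonempty]) (by simp [hq])
  rw [mem_sdiff] at hu hv
  have hv' : v ∈ F' := by by_contra h'; exact hv ⟨hvF, h'⟩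
  exact hu.2 (hcl v hv' u (hFW hu.1) huv.symm)

theorem ConnTo.insert_of_adj {X : Finset V} {x a b : V} (h : ConnTo G X x) (hb : b ∈ X)
    (hab : G.Adj b a) : ConnTo G (insert a X) x := by
  refine ⟨mem_insert_of_mem h.1, fun C hC hne hx => ?_⟩
  by_cases hCX : (C ∩ X).Nonempty
  · obtain ⟨u, hu, v, hvX, hv, huv⟩ := h.2 (C ∩ X) inter_subset_right hCX (by simp [hx])
    exact ⟨u, (mem_inter.1 hu).1, v, mem_insert_of_mem hvX,
      fun hvC => hv (mem_inter.2 ⟨hvC, hvX⟩), huv⟩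
  · obtain ⟨u, hu⟩ := hne
    have hbC : b ∉ C := fun hbC => hCX ⟨b, mem_inter.2 ⟨hbC, hb⟩⟩
    have hua : u = a := (mem_insert.1 (hC hu)).resolve_right
      fun huX => hCX ⟨u, mem_inter.2 ⟨hu, huX⟩⟩
    exact ⟨u, hu, b, mem_insert_of_mem hb, hbC, hua ▸ hab.symm⟩

/-! ### Paths in complete bipartite graphs -/

section Prefix

/-- Reserve `t` and some `s'` in `S`; a path two shorter ends at another `t'` in the rest and is
prolonged through `t'`, `s'`, `t`. -/
theorem linked_biclique_odd (i : ℕ) : ∀ {S T : Finset V} {x t : V}, x ∈ S → t ∈ T →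
    (∀ s ∈ S, ∀ t ∈ T, G.Adj s t) → i + 1 ≤ #S → i + 1 ≤ #T →
    Linked G (S ∪ T) x t (2 * i + 1) := by
  induction i with
  | zero =>
    intro S T x t hx ht hST _ _
    exact Linked.of_adj (hST x hx t ht) (mem_union_left _ hx) (mem_union_right _ ht)
  | succ i ih =>
    intro S T x t hx ht hST hS hT
    have hdisj : ∀ v ∈ S, v ∉ T := fun v hv hv' => G.irrefl (hST v hv v hv')
    have hS' : #(S.erase x) = #S - 1 := card_erase_of_mem hx
    have hT' : #(T.erase t) = #T - 1 := card_erase_of_mem ht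
    obtain ⟨s', hs'⟩ : (S.erase x).Nonempty := card_pos.1 (by omega)
    obtain ⟨t', ht'⟩ : (T.erase t).Nonempty := card_pos.1 (by omega)
    have hs'S := mem_of_mem_erase hs'
    have ht'T := mem_of_mem_erase ht'
    have h1 := ih (S := S.erase s') (T := T.erase t) (x := x) (t := t')
      (mem_erase.2 ⟨(ne_of_mem_erase hs').symm, hx⟩) ht'
      (fun s hs t ht => hST s (mem_of_mem_erase hs) t (mem_of_mem_erase ht))
      (by rw [card_erase_of_mem hs'S]; omega) (by omega)
    have h2 : Linked G {s', t'} t' s' 1 :=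
      Linked.of_adj (hST s' hs'S t' ht'T).symm (by simp) (by simp)
    have h3 : Linked G {s', t} s' t 1 := Linked.of_adj (hST s' hs'S t ht) (by simp) (by simp)
    have h4 : Linked G (insert s' (S.erase s' ∪ T.erase t)) x s' (2 * i + 1 + 1) := by
      refine h1.append h2 ?_ (subset_insert _ _) ?_
      · intro v hv hv'
        simp only [mem_insert, mem_singleton] at hv'
        rcases hv' with rfl | rfl
        · simp only [mem_union, mem_erase, ne_eq, not_true_eq_false, false_and, false_or] at hv
          exact absurd hv.2 (hdisj _ hs'S)
        · rfl
      · intro v hv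
        simp only [mem_insert, mem_singleton] at hv
        rcases hv with rfl | rfl
        · simp
        · exact mem_insert_of_mem (mem_union_right _ ht')
    have h5 := h4.append (R := S ∪ T) h3 ?_ ?_ ?_
    · rwa [show 2 * (i + 1) + 1 = 2 * i + 1 + 1 + 1 by ring]
    · intro v hv hv'
      simp only [mem_insert, mem_singleton] at hv'
      rcases hv' with rfl | rfl
      · rfl
      · simp only [mem_insert, mem_union, mem_erase, ne_eq, not_true_eq_false, false_and,
          or_false] at hv
        rcases hv with hv | hv
        · exact hv
        · exact absurd ht (hdisj _ hv.2)
    · intro v hv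
      simp only [mem_insert, mem_union, mem_erase] at hv ⊢
      rcases hv with rfl | hv | hv
      exacts [Or.inl hs'S, Or.inl hv.2, Or.inr hv.2]
    · intro v hv
      simp only [mem_insert, mem_singleton, mem_union] at hv ⊢
      rcases hv with rfl | rfl
      exacts [Or.inl hs'S, Or.inr ht]

theorem linked_biclique_even {S T : Finset V} {x w : V} (hx : x ∈ S) (hw : w ∈ S) (hwx : w ≠ x)
    (hST : ∀ s ∈ S, ∀ t ∈ T, G.Adj s t) {i : ℕ} (hS : i + 2 ≤ #S) (hT : i + 1 ≤ #T) :
    Linked G (S ∪ T) x w (2 * i + 2) := by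
  have hdisj : ∀ v ∈ S, v ∉ T := fun v hv hv' => G.irrefl (hST v hv v hv')
  obtain ⟨t, ht⟩ : T.Nonempty := card_pos.1 (by omega)
  have h1 := linked_biclique_odd i (S := S.erase w) (T := T) (x := x) (t := t)
    (mem_erase.2 ⟨hwx.symm, hx⟩) ht (fun s hs => hST s (mem_of_mem_erase hs))
    (by rw [card_erase_of_mem hw]; omega) hT
  have h2 : Linked G {t, w} t w 1 := Linked.of_adj (hST w hw t ht).symm (by simp) (by simp)
  refine h1.append h2 ?_ (union_subset_union_left (erase_subset _ _)) ?_
  · intro v hv hv'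
    simp only [mem_insert, mem_singleton] at hv'
    rcases hv' with rfl | rfl
    · rfl
    · simp only [mem_union, mem_erase, ne_eq, not_true_eq_false, false_and, false_or] at hv
      exact absurd hv (hdisj _ hw)
  · intro v hv
    simp only [mem_insert, mem_singleton, mem_union] at hv ⊢
    rcases hv with rfl | rfl
    exacts [Or.inr ht, Or.inl hw]

end Prefix

/-! ### Two disjoint paths to a 2-separation -/

section TwoPaths

variable [Fintype V] {x y : V}

/-- A connected set containing x with connected complement containing y can grow by one vertex.
Among the neighbours `a` of `X` other than `y`, choose one that leaves the largest component of y in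
the complement. A leftover part would have a second boundary vertex, hence a neighbour in `X`, and
thus offer a better choice of `a`. -/
theorem exists_connTo_insert (cut : ∀ C : Finset V, C.Nonempty → x ∉ C → y ∉ C → 2 ≤ #(bdry G C))
    {X : Finset V} (hX : ConnTo G X x) (hY : ConnTo G Xᶜ y) (hne : ∃ a, a ∉ X ∧ a ≠ y) :
    ∃ a, a ∉ X ∧ a ≠ y ∧ (∃ u ∈ X, G.Adj u a) ∧ ConnTo G (insert a X) x ∧
      ConnTo G (insert a X)ᶜ y := by
  have hxX : x ∈ X := hX.1
  have hyX : y ∉ X := by simpa using hY.1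
  have ex : ∃ F : Finset V, ∃ a, a ∉ X ∧ a ≠ y ∧ (∃ u ∈ X, G.Adj u a) ∧ F ⊆ Xᶜ.erase a ∧
      ConnTo G F y ∧ ∀ u ∈ F, ∀ v ∈ Xᶜ.erase a, G.Adj u v → v ∈ F := by
    obtain ⟨a₀, ha₀, ha₀y⟩ := hne
    have h2 := cut (Xᶜ.erase y) ⟨a₀, by simp [ha₀, ha₀y]⟩ (by simp [hxX]) (by simp)
    obtain ⟨v, hv, hvy⟩ := exists_mem_ne (by omega : 1 < #(bdry G (Xᶜ.erase y))) y
    rw [mem_bdry] at hv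
    obtain ⟨hv, u, hu, huv⟩ := hv
    simp only [mem_erase, mem_compl, not_and, not_not] at hv hu
    obtain ⟨F, h1, h2, h3⟩ := exists_component G (W := Xᶜ.erase u) (q := y)
      (by simp [hyX, hu.1.symm])
    exact ⟨F, u, hu.2, hu.1, ⟨v, hv hvy, huv.symm⟩, h1, h2, h3⟩
  obtain ⟨F, ⟨a, haX, hay, haadj, hFW, hF, hcl⟩, hmax⟩ := exists_max_card ex
  obtain ⟨b₀, hb₀, hb₀a⟩ := haadj
  refine ⟨a, haX, hay, ⟨b₀, hb₀, hb₀a⟩, hX.insert_of_adj hb₀ hb₀a, ?_⟩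
  have hcompl : (insert a X)ᶜ = Xᶜ.erase a := by ext; simp
  rw [hcompl]
  suffices hFe : F = Xᶜ.erase a by rwa [← hFe]
  by_contra hFe
  have hL : (Xᶜ.erase a \ F).Nonempty := sdiff_nonempty.2 fun h => hFe (hFW.antisymm h)
  have h2 := cut _ hL (by simp [hxX]) (by simp [hF.1])
  obtain ⟨v, hv, hva⟩ := exists_mem_ne (by omega : 1 < #(bdry G (Xᶜ.erase a \ F))) a
  rw [mem_bdry] at hv
  obtain ⟨hv, a₂, ha₂, ha₂v⟩ := hv
  have ha₂F := (mem_sdiff.1 ha₂).2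
  have ha₂W := (mem_sdiff.1 ha₂).1
  have ha₂' : a₂ ≠ a ∧ a₂ ∉ X := by simpa using ha₂W
  have hvX : v ∈ X := by
    by_contra hvX
    have hvW : v ∈ Xᶜ.erase a := by simp [hva, hvX]
    have hvF : v ∈ F := by
      by_contra hvF
      exact hv (mem_sdiff.2 ⟨hvW, hvF⟩)
    exact ha₂F (hcl v hvF a₂ ha₂W ha₂v.symm)
  have ha₂y : a₂ ≠ y := fun h => ha₂F (h ▸ hF.1)
  obtain ⟨F₂, hF₂W, hF₂, hcl₂⟩ := exists_component G (W := Xᶜ.erase a₂) (q := y)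
    (by simp [hyX, ha₂y.symm])
  -- Removing `a₂` instead of `a` keeps the old component and also joins `a` to it.
  have hsub : F ⊆ F₂ := hF.subset_of_closed (W := Xᶜ.erase a₂) (fun w hw => by
    have := hFW hw
    simp only [mem_erase, mem_compl] at this ⊢
    exact ⟨fun h => ha₂F (h ▸ hw), this.2⟩) hF₂.1 hcl₂
  have haF : a ∉ F := fun h => by simpa using hFW h
  have haF₂ : a ∈ F₂ := by
    obtain ⟨u, hu, w, hwX, hw, huw⟩ := hY.2 (Xᶜ \ F) sdiff_subset
      ⟨a, by simp [haX, haF]⟩ (by simp [hF.1])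
    have hwF : w ∈ F := by
      by_contra h
      exact hw (mem_sdiff.2 ⟨hwX, h⟩)
    rw [mem_sdiff] at hu
    have hua : u = a := by
      by_contra hua
      exact hu.2 (hcl w hwF u (mem_erase.2 ⟨hua, hu.1⟩) huw.symm)
    subst hua
    exact hcl₂ w (hsub hwF) u (by simp [haX, ha₂'.1.symm]) huw.symm
  have h3 := hmax F₂ ⟨a₂, ha₂'.2, ha₂y, ⟨v, hvX, ha₂v.symm⟩, hF₂W, hF₂, hcl₂⟩
  have h4 : #F < #F₂ := card_lt_card ⟨hsub, fun h => haF (h haF₂)⟩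
  omega

/-- Let `X` be a largest connected set around x with connected complement that avoids `C`. It can
only grow into `C`, so one boundary vertex of `C` lies in `X`. Connectedness of the complement puts
the other one on the side of y. -/
theorem exists_two_paths (hxy : x ≠ y)
    (cut : ∀ C : Finset V, C.Nonempty → x ∉ C → y ∉ C → 2 ≤ #(bdry G C))
    {C : Finset V} (hC : C.Nonempty) (hxC : x ∉ C) (hyC : y ∉ C) (hC2 : #(bdry G C) = 2) :
    ∃ u v : V, u ≠ v ∧ bdry G C = {u, v} ∧ ∃ R₁ R₂ : Finset V, Disjoint R₁ R₂ ∧ Disjoint R₁ C ∧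
      Disjoint R₂ C ∧ (∃ n, Linked G R₁ x u n) ∧ ∃ m, Linked G R₂ v y m := by
  obtain ⟨X, ⟨hX, hY, hXC⟩, hmax⟩ := exists_max_card
    (P := fun X : Finset V => ConnTo G X x ∧ ConnTo G Xᶜ y ∧ Disjoint X C)
    ⟨{x}, ⟨by simp, fun C hC ⟨u, hu⟩ hx => by
        have := hC hu; simp only [mem_singleton] at this; exact absurd (this ▸ hu) hx⟩,
      ⟨by simpa using hxy.symm, fun C hC hne hy => by
        have hxC : x ∉ C := fun h => by simpa using hC h
        obtain ⟨v, hv, hvx⟩ := exists_mem_ne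
          (by have := cut C hne hxC hy; omega : 1 < #(bdry G C)) x
        rw [mem_bdry] at hv
        obtain ⟨hv, u, hu, huv⟩ := hv
        exact ⟨u, hu, v, by simpa using hvx, hv, huv⟩⟩, by simpa using hxC⟩
  have hCX : ∀ c ∈ C, c ∉ X := fun c hc hcX => disjoint_left.1 hXC hcX hc
  obtain ⟨c₀, hc₀⟩ := hC
  obtain ⟨a, haX, hay, ⟨u, huX, hua⟩, h1, h2⟩ := exists_connTo_insert cut hX hY
    ⟨c₀, hCX _ hc₀, fun h => hyC (h ▸ hc₀)⟩
  have haC : a ∈ C := by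
    by_contra haC
    have h3 := hmax (insert a X) ⟨h1, h2, by simp [haC, hXC]⟩
    rw [card_insert_of_notMem haX] at h3
    omega
  have huC : u ∉ C := fun h => hCX u h huX
  have hub : u ∈ bdry G C := mem_bdry.2 ⟨huC, a, haC, hua.symm⟩
  obtain ⟨c, hc, v, hvX, hvC, hcv⟩ := hY.2 C (fun c hc => by simpa using hCX c hc) ⟨c₀, hc₀⟩ hyC
  have hvX' : v ∉ X := by simpa using hvX
  have hvb : v ∈ bdry G C := mem_bdry.2 ⟨hvC, c, hc, hcv⟩
  have huv : u ≠ v := fun h => hvX' (h ▸ huX)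
  have hbd : bdry G C = {u, v} := by
    symm
    apply eq_of_subset_of_card_le
    · intro w hw
      simp only [mem_insert, mem_singleton] at hw
      rcases hw with rfl | rfl <;> assumption
    · rw [hC2, card_pair huv]
  refine ⟨u, v, huv, hbd, X, Xᶜ \ C, ?_, hXC, sdiff_disjoint, ?_, ?_⟩
  · exact disjoint_compl_right.mono_right sdiff_subset
  · obtain ⟨n, hn⟩ := hX.linked huX
    exact ⟨n, hn.symm⟩
  · have hconn : ConnTo G (Xᶜ \ C) y := by
      refine ⟨mem_sdiff.2 ⟨hY.1, hyC⟩, fun C' hC' hne hy => ?_⟩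
      have hCC' : ∀ w ∈ C, w ∉ C' := fun w hw hw' => (mem_sdiff.1 (hC' hw')).2 hw
      by_cases hvC' : v ∈ C'
      · obtain ⟨p, hp, w, hwX, hw, hpw⟩ := hY.2 (C' ∪ C)
          (union_subset (hC'.trans sdiff_subset) fun c hc => by simpa using hCX c hc)
          (hne.mono subset_union_left) (by simp [hy, hyC])
        rw [mem_union, not_or] at hw
        rw [mem_union] at hp
        rcases hp with hp | hp
        · exact ⟨p, hp, w, mem_sdiff.2 ⟨hwX, hw.2⟩, hw.1, hpw⟩
        · have : w ∈ bdry G C := mem_bdry.2 ⟨hw.2, p, hp, hpw⟩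
          rw [hbd, mem_insert, mem_singleton] at this
          rcases this with rfl | rfl
          · simp [huX] at hwX
          · exact absurd hvC' hw.1
      · obtain ⟨p, hp, w, hwX, hw, hpw⟩ := hY.2 C' (hC'.trans sdiff_subset) hne hy
        refine ⟨p, hp, w, mem_sdiff.2 ⟨hwX, fun hwC => ?_⟩, hw, hpw⟩
        have hpC : p ∉ C := (mem_sdiff.1 (hC' hp)).2
        have : p ∈ bdry G C := mem_bdry.2 ⟨hpC, w, hwC, hpw.symm⟩
        rw [hbd, mem_insert, mem_singleton] at this
        rcases this with rfl | rfl
        · have := (mem_sdiff.1 (hC' hp)).1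
          simp [huX] at this
        · exact hvC' hp
    exact hconn.linked (mem_sdiff.2 ⟨hvX, hvC⟩)

end TwoPaths

end Basics

/-! ### Contracting two vertex sets to roots -/

section Contraction

open scoped Classical

universe u
variable {V : Type u}

/-- The number of boundary vertices of `C` when `A` and `Z` are contracted to single vertices and
the remaining vertices are those of `D`. -/
noncomputable def bd [Fintype V] (G : SimpleGraph V) (A D Z C : Finset V) : ℕ :=
  #(bdry G C ∩ D) + (if Touch G A C then 1 else 0) + (if Touch G Z C then 1 else 0)

/-- Contracting the disjoint monochromatic sets `A` and `Z` gives a rooted graph on `D` that is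
2-connected after joining the roots, in which every vertex of `D` other than `z` has degree at
least `k + 1`. -/
structure SetRooted [Fintype V] (G : SimpleGraph V) (col : V → Bool) (k : ℕ) (A D Z : Finset V)
    (z : V) : Prop where
  disjAD : Disjoint A D
  disjZD : Disjoint Z D
  disjAZ : Disjoint A Z
  colA : ∃ α, ∀ a ∈ A, col a = α
  colZ : ∃ α, ∀ a ∈ Z, col a = α
  cut : ∀ C ⊆ D, C.Nonempty → 2 ≤ bd G A D Z C
  deg : ∀ v ∈ D, v ≠ z → k + 1 ≤ bd G A D Z {v}
  ex : ∃ v ∈ D, v ≠ z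

/-- There are `k` paths from `A` to `Z` through `D` whose lengths form an arithmetic progression
with difference two. -/
def SetPaths (G : SimpleGraph V) (k : ℕ) (A D Z : Finset V) : Prop :=
  ∃ n₀, 2 ≤ n₀ ∧ ∀ i < k, ∃ a ∈ A, ∃ b ∈ Z, Linked G (insert a (insert b D)) a b (n₀ + 2 * i)

/-- A bipartite graph with nonadjacent roots `x` and `y` that is 2-connected after joining the
roots, in which every vertex other than `x`, `y`, `z` has degree at least `k + 1`. -/
structure Rooted [Fintype V] (G : SimpleGraph V) (col : V → Bool) (k : ℕ) (x y z : V) : Prop where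
  proper : ∀ u v, G.Adj u v → col u ≠ col v
  ne : x ≠ y
  nadj : ¬ G.Adj x y
  cut : ∀ C : Finset V, C.Nonempty → x ∉ C → y ∉ C → 2 ≤ #(bdry G C)
  deg : ∀ v, v ≠ x → v ≠ y → v ≠ z → k + 1 ≤ #(nbr G v)
  ex : ∃ v, v ≠ x ∧ v ≠ y ∧ v ≠ z

/-- There are `k` paths from `x` to `y` whose lengths form an arithmetic progression with
difference two. -/
def RootPaths [Fintype V] (G : SimpleGraph V) (k : ℕ) (x y : V) : Prop :=
  ∃ n₀, ∀ i < k, Linked G univ x y (n₀ + 2 * i)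

/-- The adjacency relation after contracting `A` to `inr false` and `Z` to `inr true`. -/
def contractAdj (G : SimpleGraph V) (A D Z : Finset V) : D ⊕ Bool → D ⊕ Bool → Prop
  | .inl u, .inl v => G.Adj u v
  | .inl u, .inr b => Touch G (cond b Z A) {u.1}
  | .inr b, .inl u => Touch G (cond b Z A) {u.1}
  | .inr _, .inr _ => False

/-- The graph on `D` and two new vertices obtained by contracting `A` and `Z`. -/
def contract (G : SimpleGraph V) (A D Z : Finset V) : SimpleGraph (D ⊕ Bool) where
  Adj := contractAdj G A D Z
  symm := ⟨by
    rintro (u | b) (v | b') h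
    · exact SimpleGraph.Adj.symm (G := G) h
    · exact h
    · exact h
    · exact h⟩
  loopless := ⟨by
    rintro (u | b) h
    · exact G.irrefl (v := u) h
    · exact h⟩

variable {G : SimpleGraph V}

/-- A contracted vertex is on the boundary exactly when its set touches `C`, so `bd` really is the
boundary size in the contracted graph. -/
theorem card_bdry_contract [Fintype V] {A D Z C : Finset V} (C' : Finset (D ⊕ Bool)) (hC : C ⊆ D)
    (hC' : ∀ v (h : v ∈ D), Sum.inl ⟨v, h⟩ ∈ C' ↔ v ∈ C) (hb : ∀ b, Sum.inr b ∉ C') :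
    #(bdry (contract G A D Z) C') = bd G A D Z C := by
  have key1 : ∀ d : D, (Sum.inl d ∉ C' ∧ ∃ u ∈ C', (contract G A D Z).Adj u (.inl d)) ↔
      (d : V) ∈ bdry G C := by
    rintro ⟨d, hd⟩
    rw [mem_bdry, hC' d hd]
    refine and_congr_right fun _ => ⟨?_, ?_⟩
    · rintro ⟨u | b, hu, h⟩
      · exact ⟨u, (hC' u.1 u.2).1 hu, h⟩
      · exact absurd hu (hb b)
    · rintro ⟨u, hu, h⟩
      exact ⟨.inl ⟨u, hC hu⟩, (hC' u (hC hu)).2 hu, h⟩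
  have key2 : ∀ b : Bool, (Sum.inr b ∉ C' ∧ ∃ u ∈ C', (contract G A D Z).Adj u (.inr b)) ↔
      Touch G (cond b Z A) C := by
    intro b
    simp only [hb, not_false_eq_true, true_and]
    constructor
    · rintro ⟨u | b', hu, h⟩
      · obtain ⟨a, ha, c, hc, hac⟩ := h
        rw [mem_singleton] at hc
        exact ⟨a, ha, u, (hC' u.1 u.2).1 hu, hc ▸ hac⟩
      · exact absurd hu (hb b')
    · rintro ⟨a, ha, c, hc, hac⟩
      exact ⟨.inl ⟨c, hC hc⟩, (hC' c (hC hc)).2 hc, a, ha, c, by simp, hac⟩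
  rw [bdry, card_filter, Fintype.sum_sum_type, Fintype.sum_bool]
  simp only [key1, key2, cond_true, cond_false]
  rw [bd, sum_coe_sort D (fun v => if v ∈ bdry G C then 1 else 0), ← card_filter,
    filter_mem_eq_inter, inter_comm]
  ring

/-- A path that avoids the root of `A` and ends at the root of `Z` stays in `D` until its last edge.
Only that edge needs a representative in `Z`. -/
theorem exists_walk_of_contract {A D Z : Finset V} (hZD : Disjoint Z D) {u w : D ⊕ Bool}
    (p : (contract G A D Z).Walk u w) :
    w = .inr true → ∀ d, u = .inl d → p.IsPath → Sum.inr false ∉ p.support →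
      ∃ b ∈ Z, ∃ q : G.Walk d b, q.IsPath ∧ q.length = p.length ∧
        ∀ v ∈ q.support, v = b ∨ ∃ h : v ∈ D, Sum.inl ⟨v, h⟩ ∈ p.support := by
  induction p with
  | nil => intro h d h'; subst h; cases h'
  | @cons u v w h p ih =>
    rintro hw d rfl hp hf
    rw [SimpleGraph.Walk.cons_isPath_iff] at hp
    rw [SimpleGraph.Walk.support_cons, List.mem_cons, not_or] at hf
    rcases v with d' | b
    · obtain ⟨b, hb, q, hq, hlen, hsup⟩ := ih hw d' rfl hp.1 hf.2
      have hdd' : G.Adj d d' := h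
      refine ⟨b, hb, .cons hdd' q, ?_, by simp [hlen], ?_⟩
      · rw [SimpleGraph.Walk.cons_isPath_iff]
        refine ⟨hq, fun hd => ?_⟩
        rcases hsup _ hd with h1 | ⟨h1, h2⟩
        · exact disjoint_left.1 hZD hb (h1 ▸ d.2)
        · exact hp.2 h2
      · intro v hv
        rw [SimpleGraph.Walk.support_cons, List.mem_cons] at hv
        rcases hv with rfl | hv
        · exact .inr ⟨d.2, by simp⟩
        · rcases hsup v hv with h1 | ⟨h1, h2⟩
          · exact .inl h1
          · exact .inr ⟨h1, by simp [h2]⟩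
    · rcases b with _ | _
      · exact absurd p.start_mem_support hf.2
      · subst hw
        have hT : Touch G Z {d.1} := h
        obtain ⟨b, hb, c, hc, hbc⟩ := hT
        rw [mem_singleton] at hc
        subst hc
        have hp' := (SimpleGraph.Walk.isPath_iff_nil.1 hp.1).length_eq_zero
        refine ⟨b, hb, hbc.symm.toWalk, ?_, by simp [hp'], ?_⟩
        · simp [SimpleGraph.Walk.isPath_def, hbc.ne']
        · intro v hv
          simp only [SimpleGraph.Adj.toWalk, SimpleGraph.Walk.support_cons,
            SimpleGraph.Walk.support_nil, List.mem_cons, List.not_mem_nil, or_false] at hv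
          rcases hv with rfl | rfl
          · exact .inr ⟨d.2, by simp⟩
          · exact .inl rfl

/-- Edges between `A` and `Z` are discarded by the contraction, so every path between the new roots
has length at least two. -/
theorem linked_of_contract {A D Z : Finset V} (hAD : Disjoint A D) (hZD : Disjoint Z D)
    (hAZ : Disjoint A Z) {n : ℕ} (h : Linked (contract G A D Z) univ (.inr false) (.inr true) n) :
    2 ≤ n ∧ ∃ a ∈ A, ∃ b ∈ Z, Linked G (insert a (insert b D)) a b n := by
  obtain ⟨p, hp, rfl, -⟩ := h
  cases p with
  | @cons _ v _ h p =>
    rw [SimpleGraph.Walk.cons_isPath_iff] at hp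
    rcases v with d | b
    · obtain ⟨b, hb, q, hq, hlen, hsup⟩ := exists_walk_of_contract hZD p rfl d rfl hp.1 hp.2
      have hT : Touch G A {d.1} := h
      obtain ⟨a, ha, c, hc, hac⟩ := hT
      rw [mem_singleton] at hc
      subst hc
      have hmem : ∀ v ∈ q.support, v = b ∨ v ∈ D := fun v hv =>
        (hsup v hv).imp id fun h => h.1
      have hne : (d : V) ≠ b := fun h => disjoint_left.1 hZD hb (h ▸ d.2)
      refine ⟨?_, a, ha, b, hb, .cons hac q, ?_, by simp [hlen], ?_⟩
      · have : p.length ≠ 0 := fun h0 => hne (SimpleGraph.Walk.eq_of_length_eq_zero (hlen.trans h0))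
        rw [SimpleGraph.Walk.length_cons]
        omega
      · rw [SimpleGraph.Walk.cons_isPath_iff]
        refine ⟨hq, fun h => ?_⟩
        rcases hmem a h with rfl | h
        · exact disjoint_left.1 hAZ ha hb
        · exact disjoint_left.1 hAD ha h
      · intro v hv
        rw [SimpleGraph.Walk.support_cons, List.mem_cons] at hv
        rcases hv with rfl | hv
        · simp
        · rcases hmem v hv with rfl | h <;> simp [*]
    · exact absurd h id

/-- Monochromatic `A` and `Z` are what keeps the contracted graph bipartite. -/
theorem SetRooted.contract [Fintype V] {col : V → Bool} {k : ℕ} {A D Z : Finset V} {z : V}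
    (h : SetRooted G col k A D Z z) (hcol : ∀ u v, G.Adj u v → col u ≠ col v) :
    ∃ (c : D ⊕ Bool → Bool) (z' : D ⊕ Bool),
      Rooted (contract G A D Z) c k (.inr false) (.inr true) z' := by
  obtain ⟨α, hα⟩ := h.colA
  obtain ⟨β, hβ⟩ := h.colZ
  have hcol' : ∀ (b : Bool) (u : D), Touch G (cond b Z A) {u.1} → col u ≠ cond b β α := by
    rintro b u ⟨a, ha, c, hc, hac⟩
    rw [mem_singleton] at hc
    subst hc
    cases b
    · exact hα a ha ▸ (hcol _ _ hac).symm
    · exact hβ a ha ▸ (hcol _ _ hac).symm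
  refine ⟨Sum.elim (fun d => col d) (fun b => cond b β α),
    -- If z is not in `D`, a root serves as a dummy exceptional vertex.
    if hz : z ∈ D then .inl ⟨z, hz⟩ else .inr false, ?_, by simp, fun h => h, ?_, ?_, ?_⟩
  · rintro (u | b) (v | b') h
    · exact hcol _ _ h
    · exact hcol' _ _ h
    · exact (hcol' _ _ h).symm
    · exact absurd h id
  · intro C hC hx hy
    have hb : ∀ b, Sum.inr b ∉ C := by rintro (_ | _) <;> assumption
    rw [card_bdry_contract (C := D.filter fun v => ∃ h : v ∈ D, Sum.inl ⟨v, h⟩ ∈ C) C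
      (filter_subset _ _) (fun v hv => by simp [hv]) hb]
    refine h.cut _ (filter_subset _ _) ?_
    obtain ⟨u | b, hu⟩ := hC
    · exact ⟨u, by simp [hu]⟩
    · exact absurd hu (hb b)
  · rintro (v | b) hx hy hz
    · rw [← bdry_singleton, card_bdry_contract (C := {v.1}) _ (by simp)
        (fun w hw => by simp [← Subtype.val_inj]) (by simp)]
      refine h.deg _ v.2 ?_
      rintro rfl
      simp at hz
    · cases b
      · exact absurd rfl hx
      · exact absurd rfl hy
  · obtain ⟨v, hv, hvz⟩ := h.ex
    refine ⟨.inl ⟨v, hv⟩, by simp, by simp, ?_⟩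
    split_ifs with hz
    · simpa using hvz
    · simp

theorem SetRooted.paths [Fintype V] {col : V → Bool} {k : ℕ} {A D Z : Finset V} {z : V}
    (h : SetRooted G col k A D Z z) (hcol : ∀ u v, G.Adj u v → col u ≠ col v)
    (H : ∀ (W : Type u) [Fintype W] (G' : SimpleGraph W) (c : W → Bool) (x y z : W),
      Fintype.card W = #D + 2 → Rooted G' c k x y z → RootPaths G' k x y) :
    SetPaths G k A D Z := by
  rcases Nat.eq_zero_or_pos k with rfl | hk
  · exact ⟨2, le_rfl, fun i hi => absurd hi (Nat.not_lt_zero i)⟩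
  obtain ⟨c, z', hR⟩ := h.contract hcol
  obtain ⟨n₀, hn⟩ := H _ _ _ _ _ _ (by simp) hR
  exact ⟨n₀, by simpa using (linked_of_contract h.disjAD h.disjZD h.disjAZ (hn 0 hk)).1,
    fun i hi => (linked_of_contract h.disjAD h.disjZD h.disjAZ (hn i hi)).2⟩

end Contraction

/-! ### Minimal counterexamples and pieces hanging at one vertex -/

section Minimal

open scoped Classical

universe u
variable {V : Type u} {G : SimpleGraph V} {col : V → Bool} {k : ℕ} {x y z : V}

theorem Bool.eq_of_ne_of_ne {a b c : Bool} (h₁ : a ≠ c) (h₂ : b ≠ c) : a = b := by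
  revert a b c; decide

theorem exists_colour_singleton (col : V → Bool) (v : V) :
    ∃ α, ∀ a ∈ ({v} : Finset V), col a = α := ⟨col v, by simp⟩

theorem Linked.cast {R : Finset V} {a b : V} {n m : ℕ} (h : Linked G R a b n) (hnm : n = m) :
    Linked G R a b m := hnm ▸ h

theorem two_le_card_of_mem {C : Finset V} {a b : V} (ha : a ∈ C) (hb : b ∈ C) (hab : a ≠ b) :
    2 ≤ #C :=
  one_lt_card.2 ⟨a, ha, b, hb, hab⟩

/-- The `SetPaths` conclusion of the induction hypothesis for singleton roots. -/
theorem SetPaths.of_singletons {a b : V} {D : Finset V} (h : SetPaths G k {a} D {b}) :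
    ∃ n₀, ∀ i < k, Linked G (insert a (insert b D)) a b (n₀ + 2 * i) := by
  obtain ⟨n₀, -, hn⟩ := h
  refine ⟨n₀, fun i hi => ?_⟩
  obtain ⟨a', ha, b', hb, hl⟩ := hn i hi
  rw [mem_singleton] at ha hb
  subst ha hb
  exact hl

variable [Fintype V]

theorem touch_singleton_left {a : V} {C : Finset V} (ha : a ∉ C) :
    Touch G {a} C ↔ a ∈ bdry G C := by
  rw [mem_bdry]
  constructor
  · rintro ⟨b, hb, c, hc, h⟩
    rw [mem_singleton] at hb
    exact ⟨ha, c, hc, hb ▸ h.symm⟩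
  · rintro ⟨-, c, hc, h⟩
    exact ⟨a, by simp, c, hc, h.symm⟩

theorem bd_singleton_right {A D C : Finset V} {d : V} (hdC : d ∉ C) (hdD : d ∉ D) :
    bd G A D {d} C = #(bdry G C ∩ insert d D) + if Touch G A C then 1 else 0 := by
  rw [bd, touch_singleton_left hdC]
  by_cases h : d ∈ bdry G C
  · rw [inter_insert_of_mem h, card_insert_of_notMem (by simp [hdD]), if_pos h]
    ring
  · rw [inter_insert_of_notMem h, if_neg h]
    ring

theorem bd_singletons {D C : Finset V} {a d : V} (haC : a ∉ C) (hdC : d ∉ C) (had : a ≠ d)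
    (haD : a ∉ D) (hdD : d ∉ D) :
    bd G {a} D {d} C = #(bdry G C ∩ insert a (insert d D)) := by
  rw [bd_singleton_right hdC hdD, touch_singleton_left haC]
  by_cases h : a ∈ bdry G C
  · rw [inter_insert_of_mem h, card_insert_of_notMem (by simp [had, haD]), if_pos h]
  · rw [inter_insert_of_notMem h, if_neg h, add_zero]

theorem card_add_three_le {D : Finset V} {a b c : V} (ha : a ∉ D) (hb : b ∉ D) (hc : c ∉ D)
    (hab : a ≠ b) (hac : a ≠ c) (hbc : b ≠ c) : #D + 3 ≤ Fintype.card V := by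
  have h := card_le_univ (insert a (insert b (insert c D)))
  rwa [card_insert_of_notMem (by simp [*]), card_insert_of_notMem (by simp [*]),
    card_insert_of_notMem hc] at h

theorem RootPaths.symm (h : RootPaths G k x y) : RootPaths G k y x := by
  obtain ⟨n, hn⟩ := h
  exact ⟨n, fun i hi => (hn i hi).symm⟩

/-- Progressions with s and t terms have s + t - 1 distinct sums, hence the bound k + 1. -/
theorem rootPaths_of_add {s t N : ℕ} (hs : 1 ≤ s) (ht : 1 ≤ t) (hk : k + 1 ≤ s + t)
    (h : ∀ i < s, ∀ j < t, Linked G univ x y (N + 2 * (i + j))) : RootPaths G k x y := by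
  refine ⟨N, fun i hi => ?_⟩
  rcases lt_or_ge i s with his | his
  · simpa using h i his 0 (by omega)
  · have := h (s - 1) (by omega) (i - (s - 1)) (by omega)
    exact this.cast (by omega)

/-- A counterexample to the existence of `k` paths, given that this existence holds for all
smaller contractions. -/
structure Minimal (G : SimpleGraph V) (col : V → Bool) (k : ℕ) (x y z : V) : Prop
    extends Rooted G col k x y z where
  two_le : 2 ≤ k
  ih : ∀ (A D Z : Finset V) (z' : V) (k' : ℕ), #D + 2 < Fintype.card V →
    SetRooted G col k' A D Z z' → SetPaths G k' A D Z
  nosol : ¬ RootPaths G k x y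

theorem Rooted.symm (h : Rooted G col k x y z) : Rooted G col k y x z where
  proper := h.proper
  ne := h.ne.symm
  nadj := fun h' => h.nadj h'.symm
  cut := fun C hC hy hx => h.cut C hC hx hy
  deg := fun v hy hx => h.deg v hx hy
  ex := by
    obtain ⟨v, h1, h2, h3⟩ := h.ex
    exact ⟨v, h2, h1, h3⟩

theorem Minimal.symm (h : Minimal G col k x y z) : Minimal G col k y x z where
  toRooted := h.toRooted.symm
  two_le := h.two_le
  ih := h.ih
  nosol := fun h' => h.nosol h'.symm

/-- If `C` had only two boundary vertices u and v, induction would give k paths from u to v through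
`C`, and disjoint paths outside `C` from x and y to u and v extend them. `C = {z}` is excluded
because it has no vertex carrying a degree condition, and a further vertex outside `C` is needed to
make the instance smaller. -/
theorem Minimal.three_le_bdry (h : Minimal G col k x y z) {C : Finset V} (hC : C.Nonempty)
    (hx : x ∉ C) (hy : y ∉ C) (hz : C ≠ {z}) (hne : ∃ v, v ∉ C ∧ v ≠ x ∧ v ≠ y) :
    3 ≤ #(bdry G C) := by
  by_contra hcon
  have h2 : #(bdry G C) = 2 := by have := h.cut C hC hx hy; omega
  obtain ⟨u, v, huv, hbd, R₁, R₂, hR, hR₁, hR₂, ⟨n, hn⟩, m, hm⟩ :=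
    exists_two_paths h.ne h.cut hC hx hy h2
  have huC : u ∉ C := (mem_bdry.1 (by simp [hbd] : u ∈ bdry G C)).1
  have hvC : v ∉ C := (mem_bdry.1 (by simp [hbd] : v ∈ bdry G C)).1
  have hsub : ∀ C' ⊆ C, bdry G C' ⊆ insert u (insert v C) := by
    intro C' hC' w hw
    rw [mem_bdry] at hw
    obtain ⟨-, c, hc, hcw⟩ := hw
    by_cases hwC : w ∈ C
    · simp [hwC]
    · have : w ∈ bdry G C := mem_bdry.2 ⟨hwC, c, hC' hc, hcw⟩
      rw [hbd] at this
      simp only [mem_insert, mem_singleton] at this ⊢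
      tauto
  have hbdC : ∀ C' ⊆ C, bd G {u} C {v} C' = #(bdry G C') := by
    intro C' hC'
    rw [bd_singletons (fun h => huC (hC' h)) (fun h => hvC (hC' h)) huv huC hvC,
      inter_eq_left.2 (hsub C' hC')]
  have hxv : ∀ c ∈ C, c ≠ x ∧ c ≠ y := fun c hc =>
    ⟨fun h => hx (h ▸ hc), fun h => hy (h ▸ hc)⟩
  have hroot : SetRooted G col k {u} C {v} z := by
    refine ⟨by simpa using huC, by simpa using hvC, by simpa using huv, exists_colour_singleton _ _,
      exists_colour_singleton _ _, ?_, ?_, ?_⟩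
    · intro C' hC' hne'
      rw [hbdC C' hC']
      exact h.cut C' hne' (fun h => hx (hC' h)) (fun h => hy (hC' h))
    · intro w hw hwz
      rw [hbdC _ (by simpa using hw), bdry_singleton]
      exact h.deg w (hxv w hw).1 (hxv w hw).2 hwz
    · by_contra! hall
      exact hz (hC.subset_singleton_iff.1 fun w hw => by simpa using hall w hw)
  obtain ⟨w, hwC, hwx, hwy⟩ := hne
  obtain ⟨n₀, hn₀⟩ := (h.ih {u} C {v} z k
    (by have := card_add_three_le hx hy hwC h.ne hwx.symm hwy.symm; omega) hroot).of_singletons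
  refine h.nosol ⟨n + n₀ + m, fun i hi => ?_⟩
  have h1 := (hn.append (R := R₁ ∪ insert u (insert v C)) (hn₀ i hi) (fun p hp hp' => by
    simp only [mem_insert] at hp'
    rcases hp' with rfl | rfl | hp'
    · rfl
    · exact absurd hm.left_mem (disjoint_left.1 hR hp)
    · exact absurd hp' (disjoint_left.1 hR₁ hp)) subset_union_left subset_union_right).append
    (R := univ) hm (fun p hp hp' => by
    simp only [mem_union, mem_insert] at hp
    rcases hp with hp | rfl | rfl | hp
    · exact absurd hp' (disjoint_left.1 hR hp)
    · exact absurd hp' (disjoint_left.1 hR hn.right_mem)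
    · rfl
    · exact absurd hp (disjoint_left.1 hR₂ hp')) (subset_univ _) (subset_univ _)
  exact h1.cast (by ring)

/-- A complete bipartite graph on `S` and `T` with `x ∈ S`, together with a connected set `F` from
whose vertex `q` one can continue to `y`, such that contracting `T` and deleting `S` decreases the
degrees in `F` by at most `#S - 1`, with the exception of `z'`. -/
structure Stage (G : SimpleGraph V) (k : ℕ) (x y z : V) (S T F : Finset V) (q z' : V) : Prop where
  hx : x ∈ S
  adj : ∀ s ∈ S, ∀ t ∈ T, G.Adj s t
  card_le : #S ≤ #T
  card_le_k : #S ≤ k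
  hFS : Disjoint F S
  hFT : Disjoint F T
  conn : ConnTo G F q
  closed : ∀ v ∈ F, v ≠ q → v ≠ z' → ∀ u, G.Adj v u → u ∈ F ∨ u ∈ S ∨ u ∈ T
  degS : ∀ v ∈ F, v ≠ q → v ≠ z' → #(nbr G v ∩ S) < #S
  degT : ∀ v ∈ F, v ≠ q → v ≠ z' → #S = k ∨ #(nbr G v ∩ T) ≤ #S
  hz : z ∈ F → z = z' ∨ z = q
  hyS : y ∉ S
  hyT : y ∉ T
  tail : ∃ R m, Linked G R q y m ∧ Disjoint R S ∧ Disjoint R T ∧ ∀ v ∈ R, v ∈ F → v = q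

/-- A part of `F` that is only attached to `d` within `F` and not attached to `T`. -/
structure IsPiece (G : SimpleGraph V) (T F : Finset V) (q : V) (C : Finset V) (d : V) : Prop where
  sub : C ⊆ F
  ne : C.Nonempty
  hq : q ∉ C
  hT : ¬ Touch G T C
  hdF : d ∈ F
  hdC : d ∉ C
  bdry : ∀ v ∈ bdry G C, v ∈ F → v = d

variable {S T F C : Finset V} {q z' d : V}

theorem Stage.disjST (hs : Stage G k x y z S T F q z') : Disjoint S T :=
  disjoint_left.2 fun v hv hv' => G.irrefl (hs.adj v hv v hv')

theorem Stage.y_eq (hs : Stage G k x y z S T F q z') (hy : y ∈ F) : y = q := by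
  obtain ⟨R, m, h, -, -, h1⟩ := hs.tail
  exact h1 y h.right_mem hy

theorem Stage.x_notMem (hs : Stage G k x y z S T F q z') : x ∉ F :=
  fun h => disjoint_left.1 hs.hFS h hs.hx

theorem Stage.x_notMem' (hs : Stage G k x y z S T F q z') : x ∉ T :=
  fun h => disjoint_left.1 hs.disjST hs.hx h

theorem Stage.pos (hs : Stage G k x y z S T F q z') : 1 ≤ #S := card_pos.2 ⟨x, hs.hx⟩

theorem Stage.deg (hs : Stage G k x y z S T F q z') (h : Minimal G col k x y z) {v : V}
    (hv : v ∈ F) (hvq : v ≠ q) (hvz : v ≠ z') : k + 1 ≤ #(nbr G v) := by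
  refine h.deg v (fun h => hs.x_notMem (h ▸ hv)) ?_ ?_
  · rintro rfl
    exact hvq (hs.y_eq hv)
  · rintro rfl
    exact (hs.hz hv).elim hvz hvq

theorem Stage.col_eq (hs : Stage G k x y z S T F q z') (h : Minimal G col k x y z) :
    (∃ α, ∀ a ∈ S, col a = α) ∧ ∃ α, ∀ a ∈ T, col a = α := by
  obtain ⟨t, ht⟩ : T.Nonempty := card_pos.1 (hs.pos.trans hs.card_le)
  refine ⟨⟨col x, fun a ha => ?_⟩, ⟨col t, fun a ha => ?_⟩⟩
  · exact Bool.eq_of_ne_of_ne (h.proper _ _ (hs.adj a ha t ht)) (h.proper _ _ (hs.adj x hs.hx t ht))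
  · exact Bool.eq_of_ne_of_ne (h.proper _ _ (hs.adj x hs.hx a ha)).symm
      (h.proper _ _ (hs.adj x hs.hx t ht)).symm

/-- Within `F` the set `C` can be entered only through `d`, so no route to `q` needs it. -/
theorem IsPiece.connTo (hp : IsPiece G T F q C d) (hs : Stage G k x y z S T F q z') :
    ConnTo G (F \ C) q := by
  refine ⟨mem_sdiff.2 ⟨hs.conn.1, hp.hq⟩, fun C' hC' hne hq => ?_⟩
  by_cases hdC' : d ∈ C'
  · obtain ⟨u, hu, v, hvF, hv, huv⟩ := hs.conn.2 (C' ∪ C)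
      (union_subset (hC'.trans sdiff_subset) hp.sub) (hne.mono subset_union_left)
      (by simp [hq, hp.hq])
    rw [mem_union, not_or] at hv
    rw [mem_union] at hu
    rcases hu with hu | hu
    · exact ⟨u, hu, v, mem_sdiff.2 ⟨hvF, hv.2⟩, hv.1, huv⟩
    · have := hp.bdry v (mem_bdry.2 ⟨hv.2, u, hu, huv⟩) hvF
      exact absurd (this ▸ hdC') hv.1
  · obtain ⟨u, hu, v, hvF, hv, huv⟩ := hs.conn.2 C' (hC'.trans sdiff_subset) hne hq
    refine ⟨u, hu, v, mem_sdiff.2 ⟨hvF, fun hvC => ?_⟩, hv, huv⟩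
    have hu' := mem_sdiff.1 (hC' hu)
    have := hp.bdry u (mem_bdry.2 ⟨hu'.2, v, hvC, huv.symm⟩) hu'.1
    exact hdC' (this ▸ hu)

theorem IsPiece.tail (hp : IsPiece G T F q C d) (hs : Stage G k x y z S T F q z') :
    ∃ R m, Linked G R d y m ∧ Disjoint R S ∧ Disjoint R T ∧ Disjoint R C := by
  obtain ⟨n, hn⟩ := (hp.connTo hs).linked (mem_sdiff.2 ⟨hp.hdF, hp.hdC⟩)
  obtain ⟨R, m, hm, hRS, hRT, hRF⟩ := hs.tail
  refine ⟨F \ C ∪ R, n + m, hn.append hm (fun v hv hv' => hRF v hv' (mem_sdiff.1 hv).1)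
    subset_union_left subset_union_right, ?_, ?_, ?_⟩
  · exact disjoint_union_left.2 ⟨hs.hFS.mono_left sdiff_subset, hRS⟩
  · exact disjoint_union_left.2 ⟨hs.hFT.mono_left sdiff_subset, hRT⟩
  · refine disjoint_union_left.2 ⟨sdiff_disjoint, disjoint_left.2 fun v hv hv' => ?_⟩
    exact hp.hq (hRF v hv (hp.sub hv') ▸ hv')

/-- Paths that leave the complete bipartite graph from a vertex of `S` other than `x`. -/
theorem Stage.rootPaths_of_side (hs : Stage G k x y z S T F q z') (h3 : 2 ≤ #S)
    (hCS : Disjoint C S) (hCT : Disjoint C T)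
    (hC : SetPaths G (k + 2 - #S) (S.erase x) C {d})
    (htail : ∃ R m, Linked G R d y m ∧ Disjoint R S ∧ Disjoint R T ∧ Disjoint R C) :
    RootPaths G k x y := by
  obtain ⟨n₀, -, hn₀⟩ := hC
  obtain ⟨R, m, hm, hRS, hRT, hRC⟩ := htail
  have hk := hs.card_le_k
  refine rootPaths_of_add (s := #S - 1) (t := k + 2 - #S) (N := n₀ + 2 + m) (by omega) (by omega)
    (by omega) fun i hi j hj => ?_
  obtain ⟨w, hw, d', hd', hl⟩ := hn₀ j hj
  rw [mem_singleton] at hd'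
  subst hd'
  rw [mem_erase] at hw
  have h1 := linked_biclique_even (i := i) hs.hx hw.2 hw.1 hs.adj (by omega)
    (by have := hs.card_le; omega)
  have h2 := (h1.append (R := S ∪ T ∪ insert w (insert d' C)) hl (fun v hv hv' => by
    simp only [mem_insert] at hv'
    rcases hv' with rfl | rfl | hv'
    · rfl
    · rw [mem_union] at hv
      exact absurd hm.left_mem (hv.elim (fun h => disjoint_right.1 hRS h)
        (fun h => disjoint_right.1 hRT h))
    · rw [mem_union] at hv
      exact hv.elim (fun h => absurd h (disjoint_left.1 hCS hv'))
        (fun h => absurd h (disjoint_left.1 hCT hv'))) subset_union_left subset_union_right).append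
    (R := univ) hm (fun v hv hv' => by
    simp only [mem_union, mem_insert] at hv
    rcases hv with (hv | hv) | rfl | rfl | hv
    · exact absurd hv (disjoint_left.1 hRS hv')
    · exact absurd hv (disjoint_left.1 hRT hv')
    · exact absurd hw.2 (disjoint_left.1 hRS hv')
    · rfl
    · exact absurd hv (disjoint_left.1 hRC hv')) (subset_univ _) (subset_univ _)
  exact h2.cast (by ring)

/-- A vertex touching `S∖{x}` loses at most |S| - 1 neighbours in `S` and regains one by the
contraction. Otherwise it loses at most x, and |S| ≥ 3 makes up for that. -/
theorem Stage.deg_side (hs : Stage G k x y z S T F q z') {v : V} (h3 : 3 ≤ #S)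
    (hdC : d ∉ C) (hv : v ∈ C) (hdeg : k + 1 ≤ #(nbr G v)) (hdS : #(nbr G v ∩ S) < #S)
    (hsub : ∀ u, G.Adj v u → u ∈ insert d C ∪ S) :
    k + 2 - #S + 1 ≤ bd G (S.erase x) C {d} {v} := by
  rw [bd_singleton_right (by rw [mem_singleton]; rintro rfl; exact hdC hv) hdC, bdry_singleton]
  have h1 : #(nbr G v) ≤ #(nbr G v ∩ insert d C) + #(nbr G v ∩ S) := by
    refine (card_le_card fun u hu => ?_).trans (card_union_le _ _)
    rw [← inter_union_distrib_left]
    exact mem_inter.2 ⟨hu, hsub u (mem_nbr.1 hu)⟩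
  have hk := hs.card_le_k
  split_ifs with ht
  · omega
  · have h2 : nbr G v ∩ S ⊆ {x} := by
      intro u hu
      rw [mem_inter, mem_nbr] at hu
      rw [mem_singleton]
      by_contra hux
      exact ht ⟨u, mem_erase.2 ⟨hux, hu.2⟩, v, by simp, hu.1.symm⟩
    have := card_le_card h2
    rw [card_singleton] at this
    omega

/-- In a smallest piece avoiding `z'` all degrees are large and all smaller cuts are good. Induction
then gives paths from `S∖{x}`, or from x itself if |S| = 2, through the piece to `d`, and `d` is
joined to y outside the piece. -/
theorem Stage.mem_piece (hs : Stage G k x y z S T F q z') (h : Minimal G col k x y z)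
    (hp : IsPiece G T F q C d) : z' ∈ C := by
  by_contra hzC
  obtain ⟨C, ⟨⟨d, hp⟩, hzC⟩, hmin⟩ := exists_min_card
    (P := fun C => (∃ d, IsPiece G T F q C d) ∧ z' ∉ C) ⟨C, ⟨d, hp⟩, hzC⟩
  have hxC : x ∉ C := fun h' => hs.x_notMem (hp.sub h')
  have hyC : y ∉ C := fun h' => hp.hq (hs.y_eq (hp.sub h') ▸ h')
  have hCS : Disjoint C S := hs.hFS.mono_left hp.sub
  have hCT : Disjoint C T := hs.hFT.mono_left hp.sub
  have hdS : d ∉ S := disjoint_left.1 hs.hFS hp.hdF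
  have hdT : d ∉ T := disjoint_left.1 hs.hFT hp.hdF
  have hdx : d ≠ x := fun h' => hdS (h' ▸ hs.hx)
  obtain ⟨t, ht⟩ : T.Nonempty := card_pos.1 (hs.pos.trans hs.card_le)
  have hnez : ∀ v ∈ C, v ≠ z' ∧ v ≠ q := fun v hv =>
    ⟨fun h => hzC (h ▸ hv), fun h => hp.hq (h ▸ hv)⟩
  have hsub : ∀ v ∈ C, ∀ u, G.Adj v u → u ∈ insert d C ∪ S := by
    intro v hv u huv
    rw [mem_union, mem_insert]
    by_cases huC : u ∈ C
    · exact .inl (.inr huC)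
    rcases hs.closed v (hp.sub hv) (hnez v hv).2 (hnez v hv).1 u huv with hu | hu | hu
    · exact .inl (.inl (hp.bdry u (mem_bdry.2 ⟨huC, v, hv, huv⟩) hu))
    · exact .inr hu
    · exact absurd ⟨u, hu, v, hv, huv.symm⟩ hp.hT
  have h3 : 3 ≤ #(bdry G C) := by
    refine h.three_le_bdry hp.ne hxC hyC ?_ ⟨t, fun h' => disjoint_left.1 hCT h' ht,
      fun h' => hs.x_notMem' (h' ▸ ht), fun h' => hs.hyT (h' ▸ ht)⟩
    rintro rfl
    have hzz := hnez z (mem_singleton_self z)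
    exact (hs.hz (hp.sub (mem_singleton_self z))).elim hzz.1 hzz.2
  have hbd : bdry G C ⊆ insert d S := by
    intro v hv
    rw [mem_bdry] at hv
    obtain ⟨hvC, u, hu, huv⟩ := hv
    have := hsub u hu v huv
    rw [mem_union, mem_insert] at this
    rw [mem_insert]
    tauto
  -- The piece sees only `d` and `S`, so its three boundary vertices force |S| ≥ 2.
  have h3S : 3 ≤ #S + 1 := by
    rw [← card_insert_of_notMem hdS]
    exact h3.trans (card_le_card hbd)
  have hdb : d ∈ bdry G C := by
    obtain ⟨u, hu, v, hvF, hv, huv⟩ := hs.conn.2 C hp.sub hp.ne hp.hq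
    have hvb : v ∈ bdry G C := mem_bdry.2 ⟨hv, u, hu, huv⟩
    exact hp.bdry v hvb hvF ▸ hvb
  -- A proper subset with a single boundary vertex in `C ∪ {d}` would be a smaller piece.
  have hcut : ∀ C' ⊂ C, C'.Nonempty → 2 ≤ #(bdry G C' ∩ insert d C) := by
    intro C' hC' hne
    have hCF := hC'.1.trans hp.sub
    obtain ⟨u, hu, v, hvF, hv, huv⟩ := hs.conn.2 C' hCF hne (fun h' => hp.hq (hC'.1 h'))
    have hvb : v ∈ bdry G C' := mem_bdry.2 ⟨hv, u, hu, huv⟩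
    have hmem : ∀ w ∈ bdry G C', w ∈ F → w ∈ bdry G C' ∩ insert d C := by
      intro w hw hwF
      refine mem_inter.2 ⟨hw, mem_insert.2 ?_⟩
      rw [or_iff_not_imp_right]
      intro hwC
      obtain ⟨-, c, hc, hcw⟩ := mem_bdry.1 hw
      exact hp.bdry w (mem_bdry.2 ⟨hwC, c, hC'.1 hc, hcw⟩) hwF
    by_contra hcon
    have hpiece : IsPiece G T F q C' v := by
      refine ⟨hCF, hne, fun h' => hp.hq (hC'.1 h'), ?_, hvF, hv, ?_⟩
      · rintro ⟨a, ha, c, hc, hac⟩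
        exact hp.hT ⟨a, ha, c, hC'.1 hc, hac⟩
      · intro w hw hwF
        by_contra hwv
        exact hcon (two_le_card_of_mem (hmem w hw hwF) (hmem v hvb hvF) hwv)
    have h4 := hmin C' ⟨⟨v, hpiece⟩, fun h' => hzC (hC'.1 h')⟩
    have h5 := card_lt_card hC'
    omega
  have hdeg : ∀ v ∈ C, k + 1 ≤ #(nbr G v) := fun v hv =>
    hs.deg h (hp.sub hv) (hnez v hv).2 (hnez v hv).1
  have hdegS : ∀ v ∈ C, #(nbr G v ∩ S) < #S := fun v hv =>
    hs.degS v (hp.sub hv) (hnez v hv).2 (hnez v hv).1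
  -- For |S| = 2 contraction of `S∖{x}` would leave a neighbour of x one short of degree k + 1, so x
  -- stays a root and all k paths are found at once.
  rcases (show #S = 2 ∨ 3 ≤ #S by omega) with hS2 | hS3
  · obtain ⟨w, hw⟩ : (S.erase x).Nonempty :=
      card_pos.1 (by rw [card_erase_of_mem hs.hx]; omega)
    have hwS := mem_of_mem_erase hw
    have hwx := ne_of_mem_erase hw
    have hwC : w ∉ C := disjoint_right.1 hCS hwS
    have hwd : w ≠ d := fun h' => hdS (h' ▸ hwS)
    have hSe : S = {x, w} := by
      symm
      apply eq_of_subset_of_card_le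
      · intro v hv
        simp only [mem_insert, mem_singleton] at hv
        rcases hv with rfl | rfl
        exacts [hs.hx, hwS]
      · rw [hS2, card_pair hwx.symm]
    have hbe : bdry G C = insert d S :=
      eq_of_subset_of_card_le hbd (by rw [card_insert_of_notMem hdS]; omega)
    have hxb : x ∈ bdry G C := by rw [hbe]; simp [hs.hx]
    have hwb : w ∈ bdry G C := by rw [hbe]; simp [hwS]
    have hTc := hs.card_le
    obtain ⟨t', ht', htt'⟩ := exists_mem_ne (by omega : 1 < #T) t
    have key : ∀ (D : Finset V) (e : V), C ⊆ D → D ⊆ insert w C →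
        (∀ C' ⊆ D, C'.Nonempty → 2 ≤ #(bdry G C' ∩ insert x (insert d D))) →
        (∀ v ∈ D, v ≠ e → k + 1 ≤ #(nbr G v ∩ insert x (insert d D))) → (∃ v ∈ D, v ≠ e) →
        False := by
      intro D e hCD hDC hcutD hdegD hex
      have hxD : x ∉ D := fun h' => by
        have := hDC h'
        simp only [mem_insert] at this
        exact this.elim (fun h => hwx h.symm) hxC
      have hdD : d ∉ D := fun h' => by
        have := hDC h'
        simp only [mem_insert] at this
        exact this.elim (fun h => hwd h.symm) hp.hdC
      have htD : ∀ t ∈ T, t ∉ D := fun t ht h' => by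
        have := hDC h'
        simp only [mem_insert] at this
        exact this.elim (fun h => disjoint_left.1 hs.disjST hwS (h ▸ ht))
          (fun h => disjoint_left.1 hCT h ht)
      have hroot : SetRooted G col k {x} D {d} e := by
        refine ⟨by simpa using hxD, by simpa using hdD, by simpa using hdx.symm,
          exists_colour_singleton _ _,
          exists_colour_singleton _ _, ?_, ?_, hex⟩
        · intro C' hC' hne
          rw [bd_singletons (fun h' => hxD (hC' h')) (fun h' => hdD (hC' h')) hdx.symm hxD hdD]
          exact hcutD C' hC' hne
        · intro v hv hve
          rw [bd_singletons _ _ hdx.symm hxD hdD, bdry_singleton]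
          · exact hdegD v hv hve
          · rw [mem_singleton]; rintro rfl; exact hxD hv
          · rw [mem_singleton]; rintro rfl; exact hdD hv
      obtain ⟨n₀, hn₀⟩ := (h.ih {x} D {d} e k (by
        have := card_add_three_le hxD (htD t ht) (htD t' ht')
          (fun h' => hs.x_notMem' (h' ▸ ht)) (fun h' => hs.x_notMem' (h' ▸ ht')) htt'.symm
        omega) hroot).of_singletons
      obtain ⟨R, m, hm, hRS, hRT, hRC⟩ := hp.tail hs
      refine h.nosol ⟨n₀ + m, fun i hi => ?_⟩
      refine ((hn₀ i hi).append hm (fun v hv hv' => ?_) (subset_univ _) (subset_univ _)).cast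
        (by ring)
      simp only [mem_insert] at hv
      rcases hv with rfl | rfl | hv
      · exact absurd hs.hx (disjoint_left.1 hRS hv')
      · rfl
      · have := hDC hv
        simp only [mem_insert] at this
        rcases this with rfl | this
        · exact absurd hwS (disjoint_left.1 hRS hv')
        · exact absurd this (disjoint_left.1 hRC hv')
    -- With two neighbours in `C ∪ {d}`, `w` can join the interior as its exceptional vertex.
    by_cases hw2 : 2 ≤ #(nbr G w ∩ insert d C)
    · refine key (insert w C) w (subset_insert _ _) subset_rfl ?_ ?_ ?_
      · intro C' hC' hne
        have hsubC : C'.erase w ⊆ C := by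
          intro v hv
          rw [mem_erase] at hv
          exact (mem_insert.1 (hC' hv.2)).resolve_left hv.1
        have hbde : ∀ v ∈ bdry G (C'.erase w), v ≠ w → v ∈ bdry G C' := by
          intro v hv hvw
          obtain ⟨hv, u, hu, huv⟩ := mem_bdry.1 hv
          exact mem_bdry.2 ⟨fun h' => hv (mem_erase.2 ⟨hvw, h'⟩), u, mem_of_mem_erase hu, huv⟩
        rcases (C'.erase w).eq_empty_or_nonempty with he | hne'
        · have hC'w : C' = {w} := by
            refine hne.subset_singleton_iff.1 fun v hv => ?_
            rw [mem_singleton]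
            by_contra hvw
            have : v ∈ C'.erase w := mem_erase.2 ⟨hvw, hv⟩
            simp [he] at this
          rw [hC'w, bdry_singleton]
          refine hw2.trans (card_le_card (inter_subset_inter_left fun v hv => ?_))
          simp only [mem_insert] at hv ⊢
          tauto
        · rcases eq_or_ssubset_of_subset hsubC with he | hss
          · refine two_le_card_of_mem (a := x) (b := d) ?_ ?_ hdx.symm
            · exact mem_inter.2 ⟨hbde x (he ▸ hxb) hwx.symm, by simp⟩
            · exact mem_inter.2 ⟨hbde d (he ▸ hdb) hwd.symm, by simp⟩
          · refine (hcut _ hss hne').trans (card_le_card fun v hv => ?_)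
            rw [mem_inter] at hv ⊢
            have hvw : v ≠ w := by
              rintro rfl
              exact (mem_insert.1 hv.2).elim hwd hwC
            refine ⟨hbde v hv.1 hvw, ?_⟩
            have := hv.2
            simp only [mem_insert] at this ⊢
            tauto
      · intro v hv hvw
        have hvC : v ∈ C := (mem_insert.1 hv).resolve_left hvw
        rw [inter_eq_left.2]
        · exact hdeg v hvC
        · intro u hu
          have := hsub v hvC u (mem_nbr.1 hu)
          rw [hSe] at this
          simp only [mem_union, mem_insert, mem_singleton] at this ⊢
          tauto
      · obtain ⟨c, hc⟩ := hp.ne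
        exact ⟨c, mem_insert_of_mem hc, fun h' => hwC (h' ▸ hc)⟩
    -- Otherwise `w` is dropped; only its single neighbour `u` in `C` loses degree and becomes
    -- exceptional.
    · obtain ⟨-, u, huC, huw⟩ := mem_bdry.1 hwb
      have hu : u ∈ nbr G w ∩ insert d C := by simp [mem_nbr, huC, huw.symm]
      have huniq : ∀ v ∈ C, G.Adj v w → v = u := by
        intro v hv hvw
        by_contra hvu
        exact hw2 (two_le_card_of_mem (a := v) (by simp [mem_nbr, hv, hvw.symm]) hu hvu)
      refine key C u subset_rfl (subset_insert _ _) ?_ ?_ ?_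
      · intro C' hC' hne
        rcases eq_or_ssubset_of_subset hC' with rfl | hss
        · refine two_le_card_of_mem (a := x) (b := d) ?_ ?_ hdx.symm
          · exact mem_inter.2 ⟨hxb, by simp⟩
          · exact mem_inter.2 ⟨hdb, by simp⟩
        · exact (hcut _ hss hne).trans (card_le_card
            (inter_subset_inter_left (subset_insert _ _)))
      · intro v hv hvu
        rw [inter_eq_left.2]
        · exact hdeg v hv
        · intro p hp'
          have hvp := mem_nbr.1 hp'
          have := hsub v hv p hvp
          have hpw : p ≠ w := by
            rintro rfl
            exact hvu (huniq v hv hvp)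
          rw [hSe] at this
          simp only [mem_union, mem_insert, mem_singleton] at this ⊢
          tauto
      -- If `C = {u}`, then `u` is adjacent to both vertices of `S`, against `degS`.
      · by_contra! hall
        have hCu : C = {u} := hp.ne.subset_singleton_iff.1 fun v hv => by simpa using hall v hv
        obtain ⟨-, v, hv, hvx⟩ := mem_bdry.1 hxb
        have hvu := hall v hv
        subst hvu
        have h5 : S ⊆ nbr G v ∩ S := by
          intro p hp'
          refine mem_inter.2 ⟨mem_nbr.2 ?_, hp'⟩
          rw [hSe] at hp'
          simp only [mem_insert, mem_singleton] at hp'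
          rcases hp' with rfl | rfl
          exacts [hvx, huw]
        have h6 := card_le_card h5
        have h7 := hdegS v hv
        omega
  · refine h.nosol (hs.rootPaths_of_side (by omega) hCS hCT (C := C) (d := d) ?_ (hp.tail hs))
    refine h.ih _ _ _ z' _ ?_
      ⟨?_, by simpa using hp.hdC, ?_, ?_, exists_colour_singleton _ _, ?_, ?_, ?_⟩
    · have := card_add_three_le hxC hyC (fun h' => disjoint_left.1 hCT h' ht) h.ne
        (fun h' => hs.x_notMem' (h' ▸ ht)) (fun h' => hs.hyT (h' ▸ ht))
      omega
    · exact (hCS.mono_right (erase_subset _ _)).symm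
    · simp [hdS]
    · obtain ⟨α, hα⟩ := (hs.col_eq h).1
      exact ⟨α, fun a ha => hα a (mem_of_mem_erase ha)⟩
    · intro C' hC' hne
      rw [bd_singleton_right (fun h' => hp.hdC (hC' h')) hp.hdC]
      rcases eq_or_ssubset_of_subset hC' with rfl | hss
      · have h5 : 1 ≤ #(bdry G C' ∩ insert d C') :=
          card_pos.2 ⟨d, mem_inter.2 ⟨hdb, by simp⟩⟩
        have h6 : Touch G (S.erase x) C' := by
          by_contra ht'
          have h7 : bdry G C' ⊆ {d, x} := by
            intro v hv
            have := hbd hv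
            obtain ⟨-, u, hu, huv⟩ := mem_bdry.1 hv
            simp only [mem_insert, mem_singleton] at this ⊢
            refine this.imp id fun hvS => ?_
            by_contra hvx
            exact ht' ⟨v, mem_erase.2 ⟨hvx, hvS⟩, u, hu, huv.symm⟩
          have h8 := (card_le_card h7).trans (card_le_two)
          omega
        rw [if_pos h6]
        omega
      · have := hcut C' hss hne
        omega
    · intro v hv _
      exact hs.deg_side hS3 hp.hdC hv (hdeg v hv) (hdegS v hv) (hsub v hv)
    · obtain ⟨c, hc⟩ := hp.ne
      exact ⟨c, hc, (hnez c hc).1⟩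

end Minimal

/-! ### The shape of F when induction does not apply -/

section Residual

open scoped Classical

universe u
variable {V : Type u} [Fintype V] {G : SimpleGraph V} {col : V → Bool} {k : ℕ} {x y z : V}
  {S T F C : Finset V} {q z' d e : V}

/-- Paths that leave the complete bipartite graph through `T`. -/
theorem Stage.rootPaths_of_through (hs : Stage G k x y z S T F q z') {E : Finset V}
    (hEF : E ⊆ F) (hE : SetPaths G (k + 1 - #S) T E {q}) (hqE : q ∉ E) : RootPaths G k x y := by
  obtain ⟨n₀, -, hn₀⟩ := hE
  obtain ⟨R, m, hm, hRS, hRT, hRF⟩ := hs.tail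
  have hk := hs.card_le_k
  have hpos := hs.pos
  refine rootPaths_of_add (s := #S) (t := k + 1 - #S) (N := 1 + n₀ + m) hpos (by omega)
    (by omega) fun i hi j hj => ?_
  obtain ⟨t, ht, q', hq', hl⟩ := hn₀ j hj
  rw [mem_singleton] at hq'
  subst hq'
  have h1 := linked_biclique_odd i hs.hx ht hs.adj (by omega) (by have := hs.card_le; omega)
  have h2 := (h1.append (R := S ∪ T ∪ insert t (insert q' E)) hl (fun v hv hv' => by
    simp only [mem_insert] at hv'
    rw [mem_union] at hv
    rcases hv' with rfl | rfl | hv'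
    · rfl
    · exact hv.elim (fun h => absurd h (disjoint_left.1 hs.hFS hs.conn.1))
        (fun h => absurd h (disjoint_left.1 hs.hFT hs.conn.1))
    · exact hv.elim (fun h => absurd h (disjoint_left.1 hs.hFS (hEF hv')))
        (fun h => absurd h (disjoint_left.1 hs.hFT (hEF hv')))) subset_union_left
      subset_union_right).append (R := univ) hm (fun v hv hv' => by
    simp only [mem_union, mem_insert] at hv
    rcases hv with (hv | hv) | rfl | rfl | hv
    · exact absurd hv (disjoint_left.1 hRS hv')
    · exact absurd hv (disjoint_left.1 hRT hv')
    · exact absurd ht (disjoint_left.1 hRT hv')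
    · rfl
    · exact hRF v hv' (hEF hv)) (subset_univ _) (subset_univ _)
  exact h2.cast (by ring)

/-- With |S| = k the complete bipartite graph alone provides k lengths to a vertex of `T`, and a
fixed path through `F` continues to y. -/
theorem Stage.card_lt (hs : Stage G k x y z S T F q z') (h : Minimal G col k x y z)
    (hT : Touch G T F) : #S < k := by
  refine lt_of_le_of_ne hs.card_le_k fun hk => h.nosol ?_
  obtain ⟨t, ht, f, hf, htf⟩ := hT
  obtain ⟨n, hn⟩ := hs.conn.linked hf
  obtain ⟨R, m, hm, hRS, hRT, hRF⟩ := hs.tail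
  refine ⟨1 + 1 + n + m, fun i hi => ?_⟩
  have h1 := linked_biclique_odd i hs.hx ht hs.adj (by omega) (by have := hs.card_le; omega)
  have htF : t ∉ F := fun h' => disjoint_left.1 hs.hFT h' ht
  have h2 : Linked G (insert t F) t q (1 + n) :=
    (Linked.of_adj htf (R := {t, f}) (by simp) (by simp)).append hn (fun v hv hv' => by
      simp only [mem_insert, mem_singleton] at hv
      rcases hv with rfl | rfl
      · exact absurd hv' htF
      · rfl) (fun v hv => by
      simp only [mem_insert, mem_singleton] at hv ⊢
      rcases hv with rfl | rfl
      exacts [.inl rfl, .inr hf]) (subset_insert _ _)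
  have h3 := (h1.append (R := S ∪ T ∪ insert t F) h2 (fun v hv hv' => by
    simp only [mem_insert] at hv'
    rw [mem_union] at hv
    rcases hv' with rfl | hv'
    · rfl
    · exact hv.elim (fun h => absurd h (disjoint_left.1 hs.hFS hv'))
        (fun h => absurd h (disjoint_left.1 hs.hFT hv'))) subset_union_left
      subset_union_right).append (R := univ) hm (fun v hv hv' => by
    simp only [mem_union, mem_insert] at hv
    rcases hv with (hv | hv) | rfl | hv
    · exact absurd hv (disjoint_left.1 hRS hv')
    · exact absurd hv (disjoint_left.1 hRT hv')
    · exact absurd ht (disjoint_left.1 hRT hv')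
    · exact hRF v hv' hv) (subset_univ _) (subset_univ _)
  exact h3.cast (by ring)

/-- The shape of `F` when the induction hypothesis does not apply to it: apart from `q` and `e`,
it consists of a piece `C` attached to `e`. -/
structure Residual (G : SimpleGraph V) (T F : Finset V) (q z' : V) (C : Finset V) (e : V) :
    Prop where
  sub : C ⊆ F
  hq : q ∉ C
  hT : ¬ Touch G T C
  heF : e ∈ F
  heC : e ∉ C
  bdry : ∀ v ∈ bdry G C, v ∈ F → v = e
  cover : ∀ v ∈ F, v ∈ C ∨ v = q ∨ v = e
  hz : F = {q} ∨ z' ∈ C ∨ (e = z' ∧ C = ∅)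
  he : e = q ∨ (Touch G T {e} ∧ G.Adj e q)

/-- Remove a largest piece `C`, if there is one, and contract `T`. If a vertex other than `q` and
the exceptional `e` remained, induction would give k + 1 - |S| paths from `T` to `q`, to be combined
with the |S| lengths from x to `T`. -/
theorem Stage.exists_residual (hs : Stage G k x y z S T F q z') (h : Minimal G col k x y z) :
    ∃ C e, Residual G T F q z' C e := by
  -- The last hypothesis says that what remains contains no further piece. This is the cut condition
  -- for the contraction.
  have key : ∀ (C : Finset V) (e : V), C ⊆ F → q ∉ C → ConnTo G (F \ C) q →
      (∀ v ∈ F, v ∉ C → v ≠ e → v ≠ z' ∧ ∀ u ∈ C, ¬ G.Adj v u) →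
      (∀ C' ⊆ (F \ C).erase q, C'.Nonempty → ¬ Touch G T C' → ∀ v₀ ∈ F, v₀ ∉ C → v₀ ∉ C' →
        ¬ ∀ v ∈ bdry G C' ∩ (F \ C), v = v₀) →
      (∀ v ∈ F, v ∈ C ∨ v = q ∨ v = e) ∧
        (e ∈ F → e ∉ C → e ≠ q → Touch G T {e} ∧ G.Adj e q) := by
    intro C e hCF hqC hconn hdeg hval
    have hins : insert q ((F \ C).erase q) = F \ C :=
      insert_erase (mem_sdiff.2 ⟨hs.conn.1, hqC⟩)
    have hval' : ∀ C' ⊆ (F \ C).erase q, C'.Nonempty →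
        2 ≤ #(bdry G C' ∩ (F \ C)) + if Touch G T C' then 1 else 0 := by
      intro C' hC' hne
      have hC'F := hC'.trans (erase_subset _ _)
      obtain ⟨u, hu, v₀, hv₀F, hv₀, huv₀⟩ := hconn.2 C' hC'F hne
        (fun h' => by simpa using hC' h')
      have hmem : v₀ ∈ bdry G C' ∩ (F \ C) := mem_inter.2 ⟨mem_bdry.2 ⟨hv₀, u, hu, huv₀⟩, hv₀F⟩
      have hpos := card_pos.2 ⟨_, hmem⟩
      split_ifs with hT
      · omega
      · rw [mem_sdiff] at hv₀F
        have := hval C' hC' hne hT v₀ hv₀F.1 hv₀F.2 hv₀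
        push Not at this
        obtain ⟨v, hv, hvv⟩ := this
        exact two_le_card_of_mem hv hmem hvv
    have hEF : (F \ C).erase q ⊆ F := (erase_subset _ _).trans sdiff_subset
    obtain ⟨t, ht⟩ : T.Nonempty := card_pos.1 (hs.pos.trans hs.card_le)
    have hqT : q ∉ T := disjoint_left.1 hs.hFT hs.conn.1
    have hcover : ∀ v ∈ (F \ C).erase q, v = e := by
      by_contra! hex
      refine h.nosol (hs.rootPaths_of_through (E := (F \ C).erase q) hEF
        (h.ih _ _ _ e _ ?_ ⟨?_, by simp, by simpa using hqT, (hs.col_eq h).2,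
          exists_colour_singleton _ _, ?_, ?_, hex⟩) (by simp))
      · have := card_add_three_le (D := (F \ C).erase q) (a := q) (b := x) (c := t) (by simp)
          (fun h' => hs.x_notMem (hEF h')) (fun h' => disjoint_left.1 hs.hFT (hEF h') ht)
          (fun h' => hs.x_notMem (h' ▸ hs.conn.1)) (fun h' => hqT (h' ▸ ht))
          (fun h' => hs.x_notMem' (h' ▸ ht))
        omega
      · exact (hs.hFT.mono_left hEF).symm
      · intro C' hC' hne
        rw [bd_singleton_right (fun h' => by simpa using hC' h') (by simp), hins]
        exact hval' C' hC' hne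
      · intro v hv hve
        have hvq := ne_of_mem_erase hv
        have hvFC := mem_sdiff.1 (mem_of_mem_erase hv)
        have h2 := hval' {v} (by simpa using hv) (by simp)
        rw [bd_singleton_right (by simpa using hvq.symm) (by simp), hins]
        obtain ⟨hvz, hvC⟩ := hdeg v hvFC.1 hvFC.2 hve
        have hdv := hs.deg h hvFC.1 hvq hvz
        have hdS := hs.degS v hvFC.1 hvq hvz
        have hk := hs.card_le_k
        -- If |S| = k, degree two suffices and the cut condition gives it. Otherwise, as the graph
        -- is bipartite, v has neighbours in at most one of `S` and `T`: it loses at most |S| in `T`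
        -- and regains one, or at most |S| - 1 in `S`.
        rcases hs.degT v hvFC.1 hvq hvz with hsk | hdT
        · omega
        rw [bdry_singleton]
        have hsub : nbr G v ⊆ (nbr G v ∩ (F \ C)) ∪ (nbr G v ∩ S ∪ nbr G v ∩ T) := by
          intro u hu
          have huC : u ∉ C := fun h' => hvC u h' (mem_nbr.1 hu)
          have := hs.closed v hvFC.1 hvq hvz u (mem_nbr.1 hu)
          simp only [mem_union, mem_inter, mem_sdiff]
          tauto
        have h3 := (card_le_card hsub).trans ((card_union_le _ _).trans
          (Nat.add_le_add_left (card_union_le _ _) _))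
        by_cases hvT : Touch G T {v}
        · rw [if_pos hvT]
          obtain ⟨a, ha, v', hv', hav⟩ := hvT
          rw [mem_singleton] at hv'
          subst hv'
          have h4 : nbr G v' ∩ S = ∅ := by
            rw [eq_empty_iff_forall_notMem]
            intro u hu
            rw [mem_inter, mem_nbr] at hu
            obtain ⟨α, hα⟩ := (hs.col_eq h).1
            have h5 := h.proper _ _ hu.1
            have h6 := h.proper _ _ hav
            have h7 := h.proper _ _ (hs.adj u hu.2 a ha)
            exact h6 (Bool.eq_of_ne_of_ne h7.symm h5)
          rw [h4, card_empty] at h3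
          omega
        · rw [if_neg hvT]
          have h4 : nbr G v ∩ T = ∅ := by
            rw [eq_empty_iff_forall_notMem]
            intro u hu
            rw [mem_inter, mem_nbr] at hu
            exact hvT ⟨u, hu.2, v, by simp, hu.1.symm⟩
          rw [h4, card_empty] at h3
          omega
    refine ⟨fun v hv => ?_, fun heF heC heq => ?_⟩
    · by_cases hvC : v ∈ C
      · exact .inl hvC
      · by_cases hvq : v = q
        · exact .inr (.inl hvq)
        · exact .inr (.inr (hcover v (by simp [*])))
    · have heE : e ∈ (F \ C).erase q := by simp [*]
      have h2 := hval' {e} (by simpa using heE) (by simp)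
      have h3 : bdry G {e} ∩ (F \ C) ⊆ {q} := by
        intro v hv
        rw [mem_inter] at hv
        rw [mem_singleton]
        by_contra hvq
        have := hcover v (mem_erase.2 ⟨hvq, hv.2⟩)
        subst this
        simp [mem_bdry] at hv
      have h4 := card_le_card h3
      rw [card_singleton] at h4
      split_ifs at h2 with hT
      · refine ⟨hT, ?_⟩
        obtain ⟨w, hw⟩ : (bdry G {e} ∩ (F \ C)).Nonempty := card_pos.1 (by omega)
        have hwq := h3 hw
        rw [mem_singleton] at hwq
        subst hwq
        rw [mem_inter, bdry_singleton, mem_nbr] at hw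
        exact hw.1
      · omega
  by_cases hex : ∃ C d, IsPiece G T F q C d
  · obtain ⟨C, ⟨e, hp⟩, hmax⟩ := exists_max_card (P := fun C => ∃ d, IsPiece G T F q C d) hex
    have hzC := hs.mem_piece h hp
    have hadj : ∀ v ∈ F, v ∉ C → v ≠ e → ∀ u ∈ C, ¬ G.Adj v u := fun v hv hvC hve u hu hvu =>
      hve (hp.bdry v (mem_bdry.2 ⟨hvC, u, hu, hvu.symm⟩) hv)
    obtain ⟨h1, h2⟩ := key C e hp.sub hp.hq (hp.connTo hs)
      (fun v hv hvC hve => ⟨fun h' => hvC (h' ▸ hzC), hadj v hv hvC hve⟩) (by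
      intro C' hC' hne hT v₀ hv₀F hv₀C hv₀C' hall
      have hC'F : ∀ v ∈ C', v ∈ F ∧ v ∉ C := fun v hv =>
        mem_sdiff.1 (mem_of_mem_erase (hC' hv))
      have hqC' : q ∉ C' := fun h' => by simpa using hC' h'
      -- A further piece containing `e` would merge with `C` into a larger one. One avoiding `e` is
      -- a piece disjoint from `C`, although every piece contains `z'`.
      by_cases he : e ∈ C'
      · have hp' : IsPiece G T F q (C' ∪ C) v₀ := by
          refine ⟨union_subset (fun v hv => (hC'F v hv).1) hp.sub, hne.mono subset_union_left,
            by simp [hqC', hp.hq], ?_, hv₀F, by simp [hv₀C, hv₀C'], ?_⟩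
          · rintro ⟨a, ha, c, hc, hac⟩
            rcases mem_union.1 hc with hc | hc
            · exact hT ⟨a, ha, c, hc, hac⟩
            · exact hp.hT ⟨a, ha, c, hc, hac⟩
          · intro v hv hvF
            obtain ⟨hv, u, hu, huv⟩ := mem_bdry.1 hv
            rw [mem_union, not_or] at hv
            rcases mem_union.1 hu with hu | hu
            · exact hall v (mem_inter.2 ⟨mem_bdry.2 ⟨hv.1, u, hu, huv⟩,
                mem_sdiff.2 ⟨hvF, hv.2⟩⟩)
            · have := hp.bdry v (mem_bdry.2 ⟨hv.2, u, hu, huv⟩) hvF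
              exact absurd (this ▸ he) hv.1
        have h3 := hmax _ ⟨v₀, hp'⟩
        rw [card_union_of_disjoint (disjoint_left.2 fun v hv => (hC'F v hv).2)] at h3
        have := card_pos.2 hne
        omega
      · have hp' : IsPiece G T F q C' v₀ := by
          refine ⟨fun v hv => (hC'F v hv).1, hne, hqC', hT, hv₀F, hv₀C', fun v hv hvF => ?_⟩
          refine hall v (mem_inter.2 ⟨hv, mem_sdiff.2 ⟨hvF, fun hvC => ?_⟩⟩)
          obtain ⟨-, u, hu, huv⟩ := mem_bdry.1 hv
          exact hadj u (hC'F u hu).1 (hC'F u hu).2 (fun h' => he (h' ▸ hu)) v hvC huv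
        exact (hC'F _ (hs.mem_piece h hp')).2 hzC)
    refine ⟨C, e, hp.sub, hp.hq, hp.hT, hp.hdF, hp.hdC, hp.bdry, h1, .inr (.inl hzC), ?_⟩
    rw [or_iff_not_imp_left]
    exact h2 hp.hdF hp.hdC
  · obtain ⟨h1, h2⟩ := key ∅ z' (empty_subset _) (notMem_empty _) (by simpa using hs.conn)
      (fun v _ _ hv => ⟨hv, by simp⟩) (by
      intro C' hC' hne hT v₀ hv₀F _ hv₀ hall
      refine hex ⟨C', v₀, fun v hv => ?_, hne, fun h' => by simpa using hC' h', hT, hv₀F, hv₀,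
        fun v hv hvF => hall v (by simp [hv, hvF])⟩
      exact (mem_sdiff.1 (mem_of_mem_erase (hC' hv))).1)
    by_cases hzF : z' ∈ F
    · refine ⟨∅, z', empty_subset _, notMem_empty _, by simp [Touch], hzF, notMem_empty _,
        by simp [mem_bdry], h1, .inr (.inr ⟨rfl, rfl⟩), ?_⟩
      rw [or_iff_not_imp_left]
      exact h2 hzF (notMem_empty _)
    · have hFq : ∀ v ∈ F, v = q := fun v hv => by
        rcases h1 v hv with h3 | h3 | rfl
        · simp at h3
        · exact h3
        · exact absurd hv hzF
      exact ⟨∅, q, empty_subset _, notMem_empty _, by simp [Touch], hs.conn.1, notMem_empty _,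
        by simp [mem_bdry], fun v hv => .inr (.inl (hFq v hv)),
        .inl ((Nonempty.subset_singleton_iff ⟨q, hs.conn.1⟩).1 fun v hv => by
          simpa using hFq v hv), .inl rfl⟩

end Residual

/-! ### Degrees near the roots, and the first stage around y -/

section Core

open scoped Classical

universe u
variable {V : Type u} [Fintype V] {G : SimpleGraph V} {col : V → Bool} {k : ℕ} {x y z : V}
  {S T F C : Finset V} {q z' d e : V}

/-- The common neighbours of the vertices of `S`. -/
noncomputable def common (G : SimpleGraph V) (S : Finset V) : Finset V :=
  univ.filter fun t => ∀ s ∈ S, G.Adj s t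

theorem mem_common {t : V} : t ∈ common G S ↔ ∀ s ∈ S, G.Adj s t := by
  simp [common]

theorem Rooted.col_eq_of_adj (h : Rooted G col k x y z) {a b c : V} (hab : G.Adj a b)
    (hcb : G.Adj c b) : col a = col c :=
  Bool.eq_of_ne_of_ne (h.proper _ _ hab) (h.proper _ _ hcb)

theorem Rooted.not_adj_of_adj (h : Rooted G col k x y z) {a b c : V} (hab : G.Adj a b)
    (hcb : G.Adj c b) : ¬ G.Adj a c :=
  fun hac => h.proper _ _ hac (h.col_eq_of_adj hab hcb)

/-- If v were the only neighbour of x, the vertices other than x, y, v would have boundary within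
{v, y}. If they are none or just z, the at least three neighbours required of v are missing or
create a triangle. -/
theorem Minimal.two_le_card_nbr (h : Minimal G col k x y z) : 2 ≤ #(nbr G x) := by
  by_contra hcon
  obtain ⟨w₀, hw₀x, hw₀y, hw₀z⟩ := h.ex
  have h2 := h.cut ((univ.erase x).erase y) ⟨w₀, by simp [*]⟩ (by simp) (by simp)
  have hxy := h.ne
  have hk := h.two_le
  obtain ⟨v, hvC, hxv⟩ : ∃ v ∈ (univ.erase x).erase y, G.Adj x v := by
    obtain ⟨v, hv, hvy⟩ :=
      exists_mem_ne (by omega : 1 < #(bdry G ((univ.erase x).erase y))) y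
    obtain ⟨hv, u, hu, huv⟩ := mem_bdry.1 hv
    have hvx : v = x := by
      by_contra hvx
      simp [hvx, hvy] at hv
    exact ⟨u, hu, hvx ▸ huv.symm⟩
  have hvx : v ≠ x := by simp at hvC; exact hvC.2
  have hvy : v ≠ y := by simp at hvC; exact hvC.1
  have huniq : ∀ u, G.Adj x u → u = v := by
    intro u hu
    by_contra huv
    exact hcon (two_le_card_of_mem (mem_nbr.2 hu) (mem_nbr.2 hxv) huv)
  have hbd : bdry G (((univ.erase x).erase y).erase v) ⊆ {v, y} := by
    intro p hp
    obtain ⟨hp, u, hu, hup⟩ := mem_bdry.1 hp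
    simp only [mem_erase, mem_univ, and_true, not_and, not_not, ne_eq] at hp hu
    simp only [mem_insert, mem_singleton]
    by_contra! hne
    have hpx := hp hne.1 hne.2
    subst hpx
    exact hu.1 (huniq u hup.symm)
  rcases (((univ.erase x).erase y).erase v).eq_empty_or_nonempty with he | hne
  · have hall : ∀ p, p = v ∨ p = y ∨ p = x := by
      intro p
      by_contra! hp
      have : p ∈ ((univ.erase x).erase y).erase v :=
        mem_erase.2 ⟨hp.1, mem_erase.2 ⟨hp.2.1, mem_erase.2 ⟨hp.2.2, mem_univ _⟩⟩⟩
      simp [he] at this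
    have hv0 : w₀ = v := by
      rcases hall w₀ with h' | h' | h'
      exacts [h', absurd h' hw₀y, absurd h' hw₀x]
    have h3 := h.deg v hvx hvy (hv0 ▸ hw₀z)
    have h4 : nbr G v ⊆ {x, y} := by
      intro p hp
      rw [mem_nbr] at hp
      rcases hall p with rfl | rfl | rfl
      · exact absurd hp (G.irrefl)
      · simp
      · simp
    have := (card_le_card h4).trans card_le_two
    omega
  · by_cases hz : ((univ.erase x).erase y).erase v = {z}
    · have hzm : z ∈ ((univ.erase x).erase y).erase v := by simp [hz]
      simp only [mem_erase, mem_univ, and_true, ne_eq] at hzm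
      have hall : ∀ p, p = v ∨ p = y ∨ p = x ∨ p = z := by
        intro p
        by_contra! hp
        have : p ∈ ((univ.erase x).erase y).erase v :=
          mem_erase.2 ⟨hp.1, mem_erase.2 ⟨hp.2.1, mem_erase.2 ⟨hp.2.2.1, mem_univ _⟩⟩⟩
        rw [hz, mem_singleton] at this
        exact hp.2.2.2 this
      have h3 := h.deg v hvx hvy (Ne.symm hzm.1)
      have hsub : nbr G v ⊆ {x, y, z} := by
        intro p hp
        rw [mem_nbr] at hp
        rcases hall p with rfl | rfl | rfl | rfl
        · exact absurd hp (G.irrefl)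
        · simp
        · simp
        · simp
      have heq : nbr G v = {x, y, z} :=
        eq_of_subset_of_card_le hsub ((card_le_three).trans (by omega))
      have hvz : G.Adj v z := mem_nbr.1 (by simp [heq])
      have hvy' : G.Adj v y := mem_nbr.1 (by simp [heq])
      have h5 := h.cut {z} (by simp) (by simpa using Ne.symm hzm.2.2)
        (by simpa using Ne.symm hzm.2.1)
      rw [hz] at hbd
      have h6 : y ∈ bdry G {z} := by
        rw [eq_of_subset_of_card_le hbd (card_le_two.trans h5)]
        simp
      rw [bdry_singleton, mem_nbr] at h6
      exact h.not_adj_of_adj hvz h6.symm hvy'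
    · have := h.three_le_bdry hne (by simp) (by simp) hz ⟨v, by simp, hvx, hvy⟩
      have h6 := (card_le_card hbd).trans card_le_two
      omega

/-- If z had just x and one other neighbour `u`, deleting z would lower the degree of no non-root
except `u`, which becomes the new exceptional vertex. Cuts survive because they had size three. -/
theorem Minimal.three_le_card_nbr_of_adj (h : Minimal G col k x y z) (hxz : G.Adj x z) :
    3 ≤ #(nbr G z) := by
  have hzx : z ≠ x := hxz.ne'
  have hzy : z ≠ y := fun h' => h.nadj (h' ▸ hxz)
  by_contra hcon
  have hk := h.two_le
  have hd2 := h.cut {z} (by simp) (by simpa using hzx.symm) (by simpa using hzy.symm)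
  rw [bdry_singleton] at hd2
  obtain ⟨u, hu, hux⟩ := exists_mem_ne (by omega : 1 < #(nbr G z)) x
  rw [mem_nbr] at hu
  have hnz : ∀ v, G.Adj z v → v = x ∨ v = u := by
    intro v hv
    by_contra! hv'
    have : #({x, u, v} : Finset V) ≤ #(nbr G z) := by
      refine card_le_card fun p hp => ?_
      simp only [mem_insert, mem_singleton] at hp
      rcases hp with rfl | rfl | rfl
      exacts [mem_nbr.2 hxz.symm, mem_nbr.2 hu, mem_nbr.2 hv]
    rw [card_eq_three.2 ⟨x, u, v, hux.symm, hv'.1.symm, hv'.2.symm, rfl⟩] at this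
    omega
  set D : Finset V := ((univ.erase x).erase y).erase z with hD
  have hmem : ∀ v, v ∈ D ↔ v ≠ z ∧ v ≠ y ∧ v ≠ x := by intro v; simp [hD]
  have hins : insert x (insert y D) = univ.erase z := by
    ext v
    simp only [mem_insert, hmem, mem_erase, mem_univ, and_true]
    by_cases h1 : v = x
    · simp [h1, hzx.symm]
    · by_cases h2 : v = y
      · simp [h2, hzy.symm]
      · simp [h1, h2]
  have hbd : ∀ C ⊆ D, bd G {x} D {y} C = #((bdry G C).erase z) := by
    intro C hC
    rw [bd_singletons (fun h' => ((hmem _).1 (hC h')).2.2 rfl)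
      (fun h' => ((hmem _).1 (hC h')).2.1 rfl) h.ne (by simp [hmem]) (by simp [hmem]), hins,
      inter_erase, inter_univ]
  obtain ⟨n₀, hn₀⟩ := (h.ih {x} D {y} u k (by
    have := card_add_three_le (D := D) (a := x) (b := y) (c := z) (by simp [hmem])
      (by simp [hmem]) (by simp [hmem]) h.ne hzx.symm hzy.symm
    omega) ⟨by simp [hmem], by simp [hmem], by simpa using h.ne, exists_colour_singleton _ _,
      exists_colour_singleton _ _, by
      intro C hC hne
      rw [hbd C hC]
      have := h.three_le_bdry (C := C) hne (fun h' => ((hmem _).1 (hC h')).2.2 rfl)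
        (fun h' => ((hmem _).1 (hC h')).2.1 rfl)
        (fun h' => ((hmem z).1 (hC (by simp [h']))).1 rfl)
        ⟨z, fun h' => ((hmem z).1 (hC h')).1 rfl, hzx, hzy⟩
      have h4 := pred_card_le_card_erase (s := bdry G C) (a := z)
      omega, by
      intro v hv hvu
      have hv' := (hmem v).1 hv
      rw [hbd _ (by simpa using hv), bdry_singleton, erase_eq_of_notMem]
      · exact h.deg v hv'.2.2 hv'.2.1 hv'.1
      · rw [mem_nbr]
        intro hvz
        exact (hnz v hvz.symm).elim hv'.2.2 hvu, by
      by_contra! hall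
      obtain ⟨w₀, h1, h2, h3⟩ := h.ex
      have hw := hall w₀ ((hmem _).2 ⟨h3, h2, h1⟩)
      subst hw
      have h4 := h.deg w₀ h1 h2 h3
      have h5 : nbr G w₀ ⊆ {x, y, z} := by
        intro p hp
        rw [mem_nbr] at hp
        simp only [mem_insert, mem_singleton]
        by_contra! hp'
        have := hall p ((hmem p).2 ⟨hp'.2.2, hp'.2.1, hp'.1⟩)
        exact G.irrefl (this ▸ hp)
      have h6 : nbr G w₀ = {x, y, z} :=
        eq_of_subset_of_card_le h5 (card_le_three.trans (by omega))
      have h7 : G.Adj w₀ x := mem_nbr.1 (by simp [h6])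
      exact h.not_adj_of_adj hxz hu.symm h7.symm⟩).of_singletons
  exact h.nosol ⟨n₀, fun i hi => (hn₀ i hi).mono (subset_univ _)⟩

/-- Here `F` is the component of y outside `S` and its common neighbours. A vertex adjacent to all
of `S` is a common neighbour, which gives `degS`; `degT` is the maximality assumption. -/
theorem Minimal.exists_stage (h : Minimal G col k x y z) (hx : x ∈ S) (hy : y ∉ S)
    (hk : #S ≤ k) (hT : #S ≤ #(common G S))
    (hmax : #S = k ∨ ∀ v ∉ S, v ≠ y → #(nbr G v ∩ common G S) ≤ #S) :
    ∃ F, Stage G k x y z S (common G S) F y z ∧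
      ∀ v ∈ F, ∀ u, G.Adj v u → u ∈ F ∨ u ∈ S ∨ u ∈ common G S := by
  have hyT : y ∉ common G S := fun h' => h.nadj (mem_common.1 h' x hx)
  obtain ⟨F, hFW, hF, hcl⟩ := exists_component G (W := (S ∪ common G S)ᶜ) (q := y)
    (by simp [hy, hyT])
  have hF' : ∀ v ∈ F, v ∉ S ∧ v ∉ common G S := fun v hv => by simpa using hFW hv
  have hcl' : ∀ v ∈ F, ∀ u, G.Adj v u → u ∈ F ∨ u ∈ S ∨ u ∈ common G S := by
    intro v hv u hvu
    rw [or_iff_not_imp_right, not_or]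
    exact fun hu => hcl v hv u (by simp [hu]) hvu
  refine ⟨F, ⟨hx, fun s hs t ht => mem_common.1 ht s hs, hT, hk,
    disjoint_left.2 fun v hv => (hF' v hv).1, disjoint_left.2 fun v hv => (hF' v hv).2, hF,
    fun v hv _ _ => hcl' v hv, fun v hv _ _ => ?_, fun v hv hvy _ => ?_, fun _ => .inl rfl, hy,
    hyT, {y}, 0, Linked.refl (by simp), by simpa using hy, by simpa using hyT,
    fun v hv _ => by simpa using hv⟩, hcl'⟩
  · refine card_lt_card ⟨inter_subset_right, fun hsub => (hF' v hv).2 ?_⟩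
    exact mem_common.2 fun s hs => (mem_nbr.1 (mem_inter.1 (hsub hs)).1).symm
  · exact hmax.imp id fun h' => h' v (hF' v hv).1 hvy

/-- Without contact to `T` the residual shape is y with a piece `C`. If `C` is nonempty and `F ≠
{y}`, paths from `S∖{x}` through `C` to y exist by induction. -/
theorem Stage.nbr_subset_of_not_touch (hs : Stage G k x y z S T F y z)
    (h : Minimal G col k x y z)
    (hcl : ∀ v ∈ F, ∀ u, G.Adj v u → u ∈ F ∨ u ∈ S ∨ u ∈ T) (hT : ¬ Touch G T F) :
    F = {y} ∧ nbr G y ⊆ S := by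
  have hcl' : ∀ v ∈ F, ∀ u, G.Adj v u → u ∈ F ∨ u ∈ S := by
    intro v hv u hvu
    rcases hcl v hv u hvu with hu | hu | hu
    · exact .inl hu
    · exact .inr hu
    · exact absurd ⟨u, hu, v, hv, hvu.symm⟩ hT
  obtain ⟨t, ht⟩ : T.Nonempty := card_pos.1 (hs.pos.trans hs.card_le)
  have hxt : G.Adj x t := hs.adj x hs.hx t ht
  have hFy : F = {y} := by
    obtain ⟨C, e, hr⟩ := hs.exists_residual h
    have hey : e = y := by
      refine hr.he.resolve_right fun h' => hT ?_
      obtain ⟨a, ha, b, hb, hab⟩ := h'.1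
      rw [mem_singleton] at hb
      exact ⟨a, ha, e, hr.heF, hb ▸ hab⟩
    subst hey
    have hbd : ∀ C' ⊆ C, bdry G C' ⊆ insert e C ∪ S := by
      intro C' hC' v hv
      obtain ⟨-, u, hu, huv⟩ := mem_bdry.1 hv
      rw [mem_union, mem_insert]
      rcases hcl' u (hr.sub (hC' hu)) v huv with hv' | hv'
      · have := hr.cover v hv'
        tauto
      · exact .inr hv'
    -- The vertices outside `F ∪ S`, among them `T`, have their whole boundary in `S`.
    have h3 : 3 ≤ #S := by
      have htS : t ∉ S := disjoint_right.1 hs.disjST ht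
      have htF : t ∉ F := disjoint_right.1 hs.hFT ht
      have hKS : bdry G (F ∪ S)ᶜ ⊆ S := by
        intro v hv
        obtain ⟨hv, u, hu, huv⟩ := mem_bdry.1 hv
        simp only [mem_compl, mem_union, not_or, not_not, not_and] at hv hu
        by_contra hvS
        have hvF : v ∈ F := by tauto
        have := hcl' v hvF u huv.symm
        tauto
      have hne : ((F ∪ S)ᶜ).Nonempty := ⟨t, by simp [htS, htF]⟩
      have h2 := (h.cut (F ∪ S)ᶜ hne (by simp [hs.hx]) (by simp [hs.conn.1])).trans
        (card_le_card hKS)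
      have hT2 := h2.trans hs.card_le
      obtain ⟨w, hw, hwx⟩ := exists_mem_ne (by omega : 1 < #S) x
      refine (h.three_le_bdry hne (by simp [hs.hx]) (by simp [hs.conn.1]) ?_
        ⟨w, by simp [hw], hwx, fun h' => hs.hyS (h' ▸ hw)⟩).trans (card_le_card hKS)
      intro hK
      have hTK : T ⊆ {z} := by
        rw [← hK]
        intro v hv
        have h1 := disjoint_right.1 hs.disjST hv
        have h2 := disjoint_right.1 hs.hFT hv
        simp [h1, h2]
      have := card_le_card hTK
      rw [card_singleton] at this
      omega
    rcases C.eq_empty_or_nonempty with rfl | hne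
    · refine (Nonempty.subset_singleton_iff ⟨e, hs.conn.1⟩).1 fun v hv => ?_
      have := hr.cover v hv
      simpa using this
    rcases hr.hz with hF | hzC | ⟨-, rfl⟩
    · exact hF
    swap
    · simp at hne
    exfalso
    have hxC : x ∉ C := fun h' => hs.x_notMem (hr.sub h')
    have hCS : Disjoint C S := hs.hFS.mono_left hr.sub
    have hCT : Disjoint C T := hs.hFT.mono_left hr.sub
    have hCe : ∃ u ∈ C, G.Adj u e := by
      obtain ⟨u, hu, v, hvF, hv, huv⟩ := hs.conn.2 C hr.sub hne hr.hq
      have := hr.bdry v (mem_bdry.2 ⟨hv, u, hu, huv⟩) hvF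
      exact ⟨u, hu, this ▸ huv⟩
    have hmemC : ∀ v ∈ C, v ≠ x ∧ v ≠ e := fun v hv =>
      ⟨fun h' => hxC (h' ▸ hv), fun h' => hr.hq (h' ▸ hv)⟩
    refine h.nosol (hs.rootPaths_of_side (by omega) hCS hCT (C := C) (d := e) (h.ih _ _ _ z _ ?_
      ⟨(hCS.mono_right (erase_subset _ _)).symm, by simpa using hr.hq, ?_, ?_,
        exists_colour_singleton _ _, ?_, ?_, ?_⟩) ?_)
    · have := card_add_three_le hxC hr.hq (fun h' => disjoint_left.1 hCT h' ht) h.ne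
        (fun h' => hs.x_notMem' (h' ▸ ht)) (fun h' => hs.hyT (h' ▸ ht))
      omega
    · simp [hs.hyS]
    · obtain ⟨α, hα⟩ := (hs.col_eq h).1
      exact ⟨α, fun a ha => hα a (mem_of_mem_erase ha)⟩
    · intro C' hC' hne'
      rw [bd_singleton_right (fun h' => hr.hq (hC' h')) hr.hq]
      split_ifs with ht'
      · obtain ⟨u, hu, v, hvF, hv, huv⟩ := hs.conn.2 C' (hC'.trans hr.sub) hne'
          (fun h' => hr.hq (hC' h'))
        have hv' : v ∈ bdry G C' ∩ insert e C := by
          refine mem_inter.2 ⟨mem_bdry.2 ⟨hv, u, hu, huv⟩, mem_insert.2 ?_⟩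
          have := hr.cover v hvF
          tauto
        have := card_pos.2 ⟨v, hv'⟩
        omega
      · have h4 : (bdry G C').erase x ⊆ bdry G C' ∩ insert e C := by
          intro v hv
          rw [mem_erase] at hv
          refine mem_inter.2 ⟨hv.2, (mem_union.1 (hbd C' hC' hv.2)).resolve_right fun hvS => ?_⟩
          obtain ⟨-, u, hu, huv⟩ := mem_bdry.1 hv.2
          exact ht' ⟨v, mem_erase.2 ⟨hv.1, hvS⟩, u, hu, huv.symm⟩
        -- Three boundary vertices minus x leave two. Only `{z}` may have a smaller boundary, and it
        -- has three boundary vertices whenever x is one of them.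
        have h5 : 2 ≤ #((bdry G C').erase x) := by
          by_cases hz : C' = {z}
          · subst hz
            rw [bdry_singleton]
            by_cases hxz : G.Adj x z
            · have h6 := h.three_le_card_nbr_of_adj hxz
              have h7 := pred_card_le_card_erase (s := nbr G z) (a := x)
              omega
            · rw [erase_eq_of_notMem (by rw [mem_nbr]; exact fun h' => hxz h'.symm),
                ← bdry_singleton]
              exact h.cut _ (by simp) (fun h' => hxC (hC' h')) (fun h' => hr.hq (hC' h'))
          · have h6 := h.three_le_bdry hne' (fun h' => hxC (hC' h')) (fun h' => hr.hq (hC' h'))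
              hz ⟨t, fun h' => disjoint_left.1 hCT (hC' h') ht,
                fun h' => hs.x_notMem' (h' ▸ ht), fun h' => hs.hyT (h' ▸ ht)⟩
            have h7 := pred_card_le_card_erase (s := bdry G C') (a := x)
            omega
        have := card_le_card h4
        omega
    · intro v hv hvz
      refine hs.deg_side h3 hr.hq hv (h.deg v (hmemC v hv).1 (hmemC v hv).2 hvz)
        (hs.degS v (hr.sub hv) (hmemC v hv).2 hvz) fun u hvu => ?_
      rw [mem_union, mem_insert]
      rcases hcl' v (hr.sub hv) u hvu with hu | hu
      · have := hr.cover u hu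
        tauto
      · exact .inr hu
    -- If `C = {z}`, then z and y are adjacent and both have neighbours in the monochromatic set
    -- `S`, which is impossible.
    · by_contra! hall
      obtain ⟨α, hα⟩ := (hs.col_eq h).1
      have hCz : C = {z} := hne.subset_singleton_iff.1 fun v hv => by simpa using hall v hv
      subst hCz
      obtain ⟨u, hu, hze⟩ := hCe
      rw [mem_singleton] at hu
      subst hu
      have hFc : ∀ v ∈ F, v = u ∨ v = e := fun v hv => by
        have := hr.cover v hv
        simp only [mem_singleton] at this
        tauto
      obtain ⟨a, ha, hau⟩ := exists_mem_ne (by have := h.symm.two_le_card_nbr; omega :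
        1 < #(nbr G e)) u
      rw [mem_nbr] at ha
      have haS : a ∈ S := by
        refine (hcl' e hs.conn.1 a ha).resolve_left fun haF => ?_
        rcases hFc a haF with rfl | rfl
        · exact hau rfl
        · exact G.irrefl ha
      have hd2 := h.cut {u} (by simp) (by simpa using hxC) (by simpa using hr.hq)
      rw [bdry_singleton] at hd2
      obtain ⟨b, hb, hbe⟩ := exists_mem_ne (by omega : 1 < #(nbr G u)) e
      rw [mem_nbr] at hb
      have hbS : b ∈ S := by
        refine (hcl' u (hr.sub (by simp)) b hb).resolve_left fun hbF => ?_
        rcases hFc b hbF with rfl | rfl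
        · exact G.irrefl hb
        · exact hbe rfl
      have h5 := h.proper _ _ ha
      have h6 := h.proper _ _ hb
      rw [hα a haS] at h5
      rw [hα b hbS] at h6
      exact h.proper _ _ hze (Bool.eq_of_ne_of_ne h6 h5)
    · exact ⟨{e}, 0, Linked.refl (by simp), by simpa using hs.hyS, by simpa using hs.hyT,
        by simpa using hr.hq⟩
  refine ⟨hFy, fun u hu => ?_⟩
  rw [mem_nbr] at hu
  refine (hcl' y hs.conn.1 u hu).resolve_left fun huF => ?_
  rw [hFy, mem_singleton] at huF
  exact G.irrefl (huF ▸ hu)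

end Core

/-! ### Leaving a maximal complete bipartite subgraph through one vertex -/

section Exit

open scoped Classical

universe u
variable {V : Type u} [Fintype V] {G : SimpleGraph V} {col : V → Bool} {k : ℕ} {x y z : V}
  {S T F C : Finset V} {q z' d e : V}

theorem common_insert (v : V) : common G (insert v S) = common G S ∩ nbr G v := by
  ext t
  simp only [mem_inter, mem_common, mem_nbr, forall_mem_insert]
  tauto

theorem common_anti {S' : Finset V} (h : S' ⊆ S) : common G S ⊆ common G S' :=
  fun _ ht => mem_common.2 fun s hs => mem_common.1 ht s (h hs)

/-- A complete bipartite graph with `x` in the side `S`, the other side being all common neighbours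
of `S`, for which first `#S` and then `#(common G S)` is as large as possible. -/
structure MaxCore (G : SimpleGraph V) (k : ℕ) (x y : V) (S : Finset V) : Prop where
  hx : x ∈ S
  hy : y ∉ S
  card_le_k : #S ≤ k
  card_le : #S ≤ #(common G S)
  max : ∀ S' : Finset V, x ∈ S' → y ∉ S' → #S' ≤ k → #S' ≤ #(common G S') → #S' ≤ #S
  max_common : ∀ S' : Finset V, x ∈ S' → y ∉ S' → #S' ≤ #(common G S') → #S' = #S →
    #(common G S') ≤ #(common G S)

theorem Minimal.exists_maxCore (h : Minimal G col k x y z) : ∃ S, MaxCore G k x y S := by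
  have hk := h.two_le
  have h0 : ∃ S : Finset V, x ∈ S ∧ y ∉ S ∧ #S ≤ k ∧ #S ≤ #(common G S) := by
    refine ⟨{x}, by simp, by simpa using h.ne.symm, by simpa using by omega, ?_⟩
    have : common G {x} = nbr G x := by ext; simp [mem_common, mem_nbr]
    have h2 := h.two_le_card_nbr
    rw [this, card_singleton]
    omega
  obtain ⟨S₀, hS₀, hmax⟩ := exists_max_card h0
  obtain ⟨S, hS, hmax'⟩ := exists_max_image
    (univ.filter fun S : Finset V => (x ∈ S ∧ y ∉ S ∧ #S ≤ k ∧ #S ≤ #(common G S)) ∧ #S = #S₀)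
    (fun S => #(common G S)) ⟨S₀, by simpa using hS₀⟩
  simp only [mem_filter, mem_univ, true_and] at hS hmax'
  obtain ⟨⟨h1, h2, h3, h4⟩, h5⟩ := hS
  exact ⟨S, h1, h2, h3, h4, fun S' a b c d => h5 ▸ hmax S' ⟨a, b, c, d⟩,
    fun S' a b c d => hmax' S' ⟨⟨a, b, d ▸ h3, c⟩, d.trans h5⟩⟩

/-- A vertex with more than |S| neighbours among the common ones could be added to `S'`, against
maximality of |S|. -/
theorem MaxCore.card_inter_le (hm : MaxCore G k x y S) (hk : #S < k) {S' : Finset V}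
    (hx : x ∈ S') (hy : y ∉ S') (hS' : #S' = #S) {v : V} (hv : v ∉ S') (hvy : v ≠ y) :
    #(nbr G v ∩ common G S') ≤ #S' := by
  by_contra hcon
  have h1 := hm.max (insert v S') (by simp [hx]) (by simp [hy, hvy.symm])
    (by rw [card_insert_of_notMem hv]; omega)
    (by rw [card_insert_of_notMem hv, common_insert, inter_comm]; omega)
  rw [card_insert_of_notMem hv] at h1
  omega

/-- `T` meets only `e`: the piece does not touch `T`, and if `e ≠ q` then y and `e` are adjacent, so
they cannot both have neighbours in the monochromatic `T`. If z is not in `F`, the residual shape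
collapses to {y}. -/
theorem Stage.exists_exit (hs : Stage G k x y z S T F y z) (h : Minimal G col k x y z)
    (hcl : ∀ v ∈ F, ∀ u, G.Adj v u → u ∈ F ∨ u ∈ S ∨ u ∈ T) (hT : Touch G T F) :
    ∃ C e, Residual G T F y z C e ∧ (∃ t ∈ T, t ≠ z ∧ G.Adj t e) ∧
      (∀ t ∈ T, ∀ f ∈ F, G.Adj t f → f = e) ∧ (z ∈ F ∨ (F = {y} ∧ e = y ∧ nbr G y ⊆ T)) := by
  obtain ⟨C, e, hr⟩ := hs.exists_residual h
  have hTF : ∀ t ∈ T, ∀ f ∈ F, G.Adj t f → f = e := by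
    intro t ht f hf htf
    rcases hr.cover f hf with hfC | rfl | hfe
    · exact absurd ⟨t, ht, f, hfC, htf⟩ hr.hT
    · rcases hr.he with he | ⟨⟨t', ht', e', he', hte'⟩, hef⟩
      · exact he.symm
      · rw [mem_singleton] at he'
        subst he'
        have h1 := h.col_eq_of_adj (hs.adj x hs.hx t ht).symm (hs.adj x hs.hx t' ht').symm
        have h2 := h.proper _ _ htf
        rw [h1] at h2
        exact absurd (Bool.eq_of_ne_of_ne (h.proper _ _ hte').symm h2.symm) (h.proper _ _ hef)
    · exact hfe
  obtain ⟨t, ht, f, hf, htf⟩ := hT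
  have hfe := hTF t ht f hf htf
  subst hfe
  refine ⟨C, f, hr, ?_⟩
  by_cases hzF : z ∈ F
  · exact ⟨⟨t, ht, fun h' => disjoint_left.1 hs.hFT (h' ▸ hzF) ht, htf⟩, hTF, .inl hzF⟩
  · have hF : F = {y} := by
      rcases hr.hz with h' | h' | ⟨h', -⟩
      · exact h'
      · exact absurd (hr.sub h') hzF
      · exact absurd (h' ▸ hf) hzF
    have hfy : f = y := by rw [hF, mem_singleton] at hf; exact hf
    subst hfy
    have hnT : nbr G f ⊆ T := by
      intro u hu
      rw [mem_nbr] at hu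
      rcases hcl f hf u hu with hu' | hu' | hu'
      · rw [hF, mem_singleton] at hu'
        exact absurd (hu' ▸ hu) (G.irrefl)
      · exact absurd hu (h.not_adj_of_adj htf.symm (hs.adj u hu' t ht))
      · exact hu'
    obtain ⟨t', ht', htz⟩ := exists_mem_ne
      (by have := h.symm.two_le_card_nbr; omega : 1 < #(nbr G f)) z
    exact ⟨⟨t', hnT ht', htz, (mem_nbr.1 ht').symm⟩, hTF, .inr ⟨hF, rfl, hnT⟩⟩

/-- `t` has at least k + 1 > |S| + 1 neighbours, while `S` and `F` can account for at most |S| + 1.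
-/
theorem Stage.exists_nbr_outside (hs : Stage G k x y z S T F y z) (h : Minimal G col k x y z)
    (hk : #S < k) {t : V} (ht : t ∈ T) (htz : t ≠ z) (hTF : ∀ f ∈ F, G.Adj t f → f = e) :
    ∃ u, G.Adj t u ∧ u ∉ S ∧ u ∉ F := by
  by_contra! hcon
  have h1 := h.deg t (fun h' => hs.x_notMem' (h' ▸ ht)) (fun h' => hs.hyT (h' ▸ ht)) htz
  have h2 : nbr G t ⊆ insert e S := by
    intro u hu
    rw [mem_nbr] at hu
    rw [mem_insert]
    by_cases huS : u ∈ S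
    · exact .inr huS
    · exact .inl (hTF u (hcon u hu huS) hu)
  have := (card_le_card h2).trans (card_insert_le _ _)
  omega

/-- A second stage beyond `t₁`: `q` becomes `t₁`, the tail is the path from `t₁` through `e` to y,
and `F₁` is the component of `t₁` off the smaller complete bipartite graph and `F`. A vertex of `F₁`
other than `t₁` with a neighbour in `F` must have been dropped from `S`; `hw` allows only the
exceptional one. -/
theorem Stage.exit {S₁ : Finset V} {t₁ : V} (hs : Stage G k x y z S T F y z)
    (h : Minimal G col k x y z)
    (hcl : ∀ v ∈ F, ∀ u, G.Adj v u → u ∈ F ∨ u ∈ S ∨ u ∈ T) (hS₁ : S₁ ⊆ S) (hx₁ : x ∈ S₁)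
    (ht₁ : t₁ ∈ T) (hT : T ⊆ common G S₁) (hTS : #S₁ ≤ #((common G S₁).erase t₁))
    (heF : e ∈ F) (het : G.Adj t₁ e) (hey : e = y ∨ G.Adj e y)
    (hw : ∀ v ∈ S, v ∉ S₁ → v = z' ∨ ∀ u ∈ F, ¬ G.Adj v u)
    (hdT : ∀ v, v ∉ S₁ → v ∉ F → #(nbr G v ∩ (common G S₁).erase t₁) ≤ #S₁)
    (hz : z ∉ F → z = z') :
    ∃ F₁, Stage G k x y z S₁ ((common G S₁).erase t₁) F₁ t₁ z' ∧ Disjoint F₁ F ∧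
      ∀ u ∈ F₁, ∀ v, G.Adj u v → v ∉ F → v ∉ S₁ → v ∉ (common G S₁).erase t₁ → v ∈ F₁ := by
  have hxt₁ : G.Adj x t₁ := hs.adj x hs.hx t₁ ht₁
  have hy₁ : y ∉ common G S₁ := fun h' => h.nadj (mem_common.1 h' x hx₁)
  have he₁ : e ∉ common G S₁ := fun h' =>
    h.not_adj_of_adj hxt₁ het.symm (mem_common.1 h' x hx₁)
  have ht₁S : t₁ ∉ S := disjoint_right.1 hs.disjST ht₁
  have ht₁F : t₁ ∉ F := disjoint_right.1 hs.hFT ht₁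
  have ht₁S₁ : t₁ ∉ S₁ := fun h' => ht₁S (hS₁ h')
  obtain ⟨F₁, hFW, hF, hcl₁⟩ := exists_component G
    (W := (S₁ ∪ (common G S₁).erase t₁ ∪ F)ᶜ) (q := t₁)
    (by simp [ht₁F, ht₁S₁])
  have hF₁ : ∀ v ∈ F₁, v ∉ S₁ ∧ v ∉ (common G S₁).erase t₁ ∧ v ∉ F := fun v hv => by
    have := hFW hv
    rw [mem_compl, mem_union, mem_union, not_or, not_or] at this
    exact ⟨this.1.1, this.1.2, this.2⟩
  have hcl₁' : ∀ u ∈ F₁, ∀ v, G.Adj u v → v ∉ F → v ∉ S₁ → v ∉ (common G S₁).erase t₁ →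
      v ∈ F₁ := by
    intro u hu v huv h1 h2 h3
    refine hcl₁ u hu v ?_ huv
    rw [mem_compl, mem_union, mem_union, not_or, not_or]
    exact ⟨⟨h2, h3⟩, h1⟩
  refine ⟨F₁, ⟨hx₁, fun s hs t ht => mem_common.1 (mem_of_mem_erase ht) s hs, hTS,
    (card_le_card hS₁).trans hs.card_le_k, disjoint_left.2 fun v hv => (hF₁ v hv).1,
    disjoint_left.2 fun v hv => (hF₁ v hv).2.1, hF, ?_, ?_, ?_, ?_, fun h' => hs.hyS (hS₁ h'),
    fun h' => hy₁ (mem_of_mem_erase h'), ?_⟩, disjoint_left.2 fun v hv => (hF₁ v hv).2.2, hcl₁'⟩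
  · intro v hv hvt hvz u hvu
    by_cases huF : u ∈ F
    · exfalso
      obtain ⟨h1, h2, h3⟩ := hF₁ v hv
      have h4 : v ∉ common G S₁ := fun h' => h2 (mem_erase.2 ⟨hvt, h'⟩)
      rcases hcl u huF v hvu.symm with h5 | h5 | h5
      · exact h3 h5
      · rcases hw v h5 h1 with h6 | h6
        · exact hvz h6
        · exact h6 u huF hvu
      · exact h4 (hT h5)
    · have := hcl₁' v hv u hvu huF
      tauto
  · intro v hv hvt _
    obtain ⟨h1, h2, h3⟩ := hF₁ v hv
    refine card_lt_card ⟨inter_subset_right, fun hsub => h2 (mem_erase.2 ⟨hvt, ?_⟩)⟩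
    exact mem_common.2 fun s hs => (mem_nbr.1 (mem_inter.1 (hsub hs)).1).symm
  · intro v hv _ _
    obtain ⟨h1, h2, h3⟩ := hF₁ v hv
    exact .inr (hdT v h1 h3)
  · exact fun hz' => .inl (hz (hF₁ z hz').2.2)
  · have heS : e ∉ S := disjoint_left.1 hs.hFS heF
    have hR : ∃ m, Linked G {t₁, e, y} t₁ y m := by
      rcases hey with rfl | hey
      · exact ⟨1, Linked.of_adj het (by simp) (by simp)⟩
      · refine ⟨1 + 1, (Linked.of_adj (R := {t₁, e}) het (by simp) (by simp)).append
          (R₂ := {e, y}) (Linked.of_adj hey (by simp) (by simp)) ?_ ?_ ?_⟩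
        · intro v hv hv'
          simp only [mem_insert, mem_singleton] at hv hv'
          rcases hv with rfl | rfl
          · rcases hv' with rfl | rfl
            · rfl
            · exact absurd ht₁ hs.hyT
          · rfl
        · intro v hv
          simp only [mem_insert, mem_singleton] at hv ⊢
          tauto
        · intro v hv
          simp only [mem_insert, mem_singleton] at hv ⊢
          tauto
    obtain ⟨m, hm⟩ := hR
    refine ⟨_, m, hm, ?_, ?_, ?_⟩
    · rw [disjoint_left]
      intro v hv
      simp only [mem_insert, mem_singleton] at hv
      rcases hv with rfl | rfl | rfl
      exacts [fun h' => ht₁S (hS₁ h'), fun h' => heS (hS₁ h'), fun h' => hs.hyS (hS₁ h')]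
    · rw [disjoint_left]
      intro v hv
      simp only [mem_insert, mem_singleton] at hv
      rcases hv with rfl | rfl | rfl
      exacts [by simp, fun h' => he₁ (mem_of_mem_erase h'), fun h' => hy₁ (mem_of_mem_erase h')]
    · intro v hv hvF
      simp only [mem_insert, mem_singleton] at hv
      rcases hv with rfl | rfl | rfl
      · rfl
      · exact absurd heF (hF₁ v hvF).2.2
      · exact absurd hs.conn.1 (hF₁ v hvF).2.2

/-- The case in which all of `S` can be kept when one vertex of `common G S` is set aside. -/
theorem MaxCore.card_common_le (hm : MaxCore G k x y S) (h : Minimal G col k x y z)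
    (hs : Stage G k x y z S (common G S) F y z)
    (hcl : ∀ v ∈ F, ∀ u, G.Adj v u → u ∈ F ∨ u ∈ S ∨ u ∈ common G S)
    (hT : Touch G (common G S) F) : #(common G S) ≤ #S := by
  by_contra hcard
  have hk := hs.card_lt h hT
  obtain ⟨C, e, hr, ⟨t₁, ht₁, ht₁z, ht₁e⟩, hTF, hzF⟩ := hs.exists_exit h hcl hT
  have hyF := hs.conn.1
  -- Since |T| > |S|, `t` can be taken out of `T` while all of `S` is kept.
  have run : ∀ t ∈ common G S, t ≠ z → G.Adj t e → ∃ F₁ C₁ e₁ u,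
      Stage G k x y z S ((common G S).erase t) F₁ t z ∧ Disjoint F₁ F ∧
      (∀ u ∈ F₁, ∀ v, G.Adj u v → v ∉ F → v ∉ S → v ∉ (common G S).erase t → v ∈ F₁) ∧
      Residual G ((common G S).erase t) F₁ t z C₁ e₁ ∧ u ∈ F₁ ∧ G.Adj t u := by
    intro t ht htz hte
    obtain ⟨F₁, hs₁, hd₁, hcl₁⟩ := hs.exit (z' := z) (e := e) h hcl subset_rfl hs.hx ht subset_rfl
      (by rw [card_erase_of_mem ht]; omega) hr.heF hte
      (hr.he.imp id fun h' => h'.2) (fun v hv hv' => absurd hv hv')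
      (fun v hv hvF => (card_le_card (inter_subset_inter_left (erase_subset _ _))).trans
        (hm.card_inter_le hk hm.hx hm.hy rfl hv fun h' => hvF (h' ▸ hyF)))
      (fun _ => rfl)
    obtain ⟨C₁, e₁, hr₁⟩ := hs₁.exists_residual h
    obtain ⟨u, htu, huS, huF⟩ := hs.exists_nbr_outside h hk ht htz (hTF t ht)
    refine ⟨F₁, C₁, e₁, u, hs₁, hd₁, hcl₁, hr₁, hcl₁ t hs₁.conn.1 u htu huF huS fun h' => ?_, htu⟩
    exact h.not_adj_of_adj (hs.adj x hs.hx t ht) htu.symm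
      (hs.adj x hs.hx u (mem_of_mem_erase h'))
  -- The second stage needs z in its own `F₁`. Hence z is not in `F`, so `F = {y}`, and `F₁` reduces
  -- to `t` and a piece containing z.
  have run' : ∀ t ∈ common G S, t ≠ z → G.Adj t e → ∃ F₁ C₁,
      Stage G k x y z S ((common G S).erase t) F₁ t z ∧ Disjoint F₁ F ∧
      (∀ u ∈ F₁, ∀ v, G.Adj u v → v ∉ F → v ∉ S → v ∉ (common G S).erase t → v ∈ F₁) ∧
      C₁ ⊆ F₁ ∧ z ∈ C₁ ∧ t ∉ C₁ ∧ ¬ Touch G ((common G S).erase t) C₁ ∧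
      ∀ v ∈ F₁, v ∈ C₁ ∨ v = t := by
    intro t ht htz hte
    obtain ⟨F₁, C₁, e₁, u, hs₁, hd₁, hcl₁, hr₁, huF₁, htu⟩ := run t ht htz hte
    have hzF₁ : z ∈ F₁ := by
      rcases hr₁.hz with h' | h' | ⟨h', -⟩
      · rw [h', mem_singleton] at huF₁
        exact absurd (huF₁ ▸ htu) G.irrefl
      · exact hr₁.sub h'
      · exact h' ▸ hr₁.heF
    have hzF' : z ∉ F := disjoint_left.1 hd₁ hzF₁
    obtain ⟨hFy, hey, hny⟩ := hzF.resolve_left hzF'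
    subst hey
    rcases hr₁.he with rfl | ⟨⟨t', ht', e', he', hte'⟩, het⟩
    · refine ⟨F₁, C₁, hs₁, hd₁, hcl₁, hr₁.sub, ?_, hr₁.heC, hr₁.hT, fun v hv => ?_⟩
      · have := hr₁.cover z hzF₁
        tauto
      · have := hr₁.cover v hv
        tauto
    · exfalso
      rw [mem_singleton] at he'
      subst he'
      -- All neighbours of `t` lie in `S`, apart from the root (now called `e`) and `e'`.
      have hks : k ≤ #S + 1 := by
        have h1 := h.deg t (fun h' => hs.x_notMem' (h' ▸ ht)) (fun h' => hs.hyT (h' ▸ ht)) htz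
        have h2 : nbr G t ⊆ insert e (insert e' S) := by
          intro v hv
          rw [mem_nbr] at hv
          simp only [mem_insert]
          by_cases hvS : v ∈ S
          · exact .inr (.inr hvS)
          by_cases hvF : v ∈ F
          · rw [hFy, mem_singleton] at hvF
            exact .inl hvF
          refine .inr (.inl ?_)
          have hvF₁ : v ∈ F₁ := hcl₁ t hs₁.conn.1 v hv hvF hvS fun h' =>
            h.not_adj_of_adj (hs.adj x hs.hx t ht) hv.symm
              (hs.adj x hs.hx v (mem_of_mem_erase h'))
          rcases hr₁.cover v hvF₁ with h' | h' | h'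
          · have := hr₁.bdry t (mem_bdry.2 ⟨hr₁.hq, v, h', hv.symm⟩) hs₁.conn.1
            exact absurd (this ▸ het) G.irrefl
          · exact absurd (h' ▸ hv) G.irrefl
          · exact h'
        have h3 := (card_le_card h2).trans (card_insert_le _ _)
        have h4 := card_insert_le e' S
        omega
      have hxt := hs.adj x hs.hx t ht
      have heF₁ := hr₁.heF
      have he'S : e' ∉ S := disjoint_left.1 hs₁.hFS heF₁
      have he'T : e' ∉ (common G S).erase t := disjoint_left.1 hs₁.hFT heF₁
      have ht'C := mem_of_mem_erase ht'
      have hey' : e' ≠ e := fun h' => disjoint_left.1 hd₁ heF₁ (h' ▸ hyF)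
      have htS : t ∉ S := disjoint_right.1 hs.disjST ht
      -- The shortest path goes through `t` only. For i > 0, an odd path of length 2i - 1 to `t'` is
      -- prolonged by the three edges through `e'` and `t`.
      refine h.nosol ⟨2, fun i hi => ?_⟩
      rcases Nat.eq_zero_or_pos i with rfl | hi0
      · exact (Linked.of_adj (R := {x, t}) hxt (by simp) (by simp)).append (R₂ := {t, e})
          (Linked.of_adj hte (by simp) (by simp)) (fun v hv hv' => by
            simp only [mem_insert, mem_singleton] at hv hv'
            rcases hv with rfl | rfl
            · rcases hv' with rfl | rfl
              · rfl
              · exact absurd rfl h.ne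
            · rfl) (subset_univ _) (subset_univ _)
      · have h1 := linked_biclique_odd (i - 1) hs₁.hx ht' hs₁.adj (by omega)
          (by have := hs₁.card_le; omega)
        have h2 : Linked G {t', e', t, e} t' e 3 := by
          refine ⟨.cons hte' (.cons het (.cons hte .nil)), ?_, rfl, ?_⟩
          · simp only [SimpleGraph.Walk.isPath_def, SimpleGraph.Walk.support_cons,
              SimpleGraph.Walk.support_nil, List.nodup_cons, List.mem_cons, List.not_mem_nil,
              or_false, not_or, List.nodup_nil, and_true, not_false_eq_true]
            exact ⟨⟨hte'.ne, ne_of_mem_erase ht', fun h' => hs.hyT (h' ▸ ht'C)⟩,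
              ⟨het.ne, hey'⟩, hte.ne⟩
          · intro v hv
            simpa [SimpleGraph.Walk.support_cons, SimpleGraph.Walk.support_nil] using hv
        refine (h1.append h2 (fun v hv hv' => ?_) (subset_univ _) (subset_univ _)).cast
          (by omega)
        simp only [mem_insert, mem_singleton] at hv'
        rw [mem_union] at hv
        rcases hv' with rfl | rfl | rfl | rfl
        · rfl
        · exact absurd hv (not_or.2 ⟨he'S, he'T⟩)
        · exact absurd hv (not_or.2 ⟨htS, by simp⟩)
        · exact absurd hv (not_or.2 ⟨hs₁.hyS, hs₁.hyT⟩)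
  obtain ⟨F₁, C₁, hs₁, hd₁, hcl₁, hC₁, hzC₁, ht₁C₁, hT₁, hcov₁⟩ := run' t₁ ht₁ ht₁z ht₁e
  obtain ⟨hFy, hey, hny⟩ := hzF.resolve_left (disjoint_left.1 hd₁ (hC₁ hzC₁))
  subst hey
  obtain ⟨t₂, ht₂, ht₂₁⟩ := exists_mem_ne
    (by have := h.symm.two_le_card_nbr; omega : 1 < #(nbr G e)) t₁
  have ht₂T := hny ht₂
  have hCT : ∀ c ∈ C₁, c ∉ common G S := by
    intro c hc hcT
    have hct : c ≠ t₁ := fun h' => ht₁C₁ (h' ▸ hc)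
    exact disjoint_left.1 hs₁.hFT (hC₁ hc) (mem_erase.2 ⟨hct, hcT⟩)
  obtain ⟨F₂, C₂, hs₂, hd₂, hcl₂, hC₂, hzC₂, ht₂C₂, hT₂, hcov₂⟩ := run' t₂ ht₂T
    (fun h' => hCT z hzC₁ (h' ▸ ht₂T)) (mem_nbr.1 ht₂).symm
  -- Both pieces contain z. A route in `F₂` from z to `t₂` must leave `C₁`, but its only exits are
  -- `t₁`, which is not in `F₂`, and `t₂`, which `C₁` does not touch.
  obtain ⟨u, hu, v, hvF₂, hv, huv⟩ := hs₂.conn.2 (F₂ ∩ C₁) inter_subset_left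
    ⟨z, mem_inter.2 ⟨hC₂ hzC₂, hzC₁⟩⟩ (fun h' => hCT t₂ (mem_inter.1 h').2 ht₂T)
  rw [mem_inter] at hu
  have hvC₁ : v ∉ C₁ := fun h' => hv (mem_inter.2 ⟨hvF₂, h'⟩)
  have hvt₂ : v ≠ t₂ := by
    rintro rfl
    exact hT₁ ⟨v, mem_erase.2 ⟨ht₂₁, ht₂T⟩, u, hu.2, huv.symm⟩
  have hvT : v ∉ common G S := fun h' =>
    disjoint_left.1 hs₂.hFT hvF₂ (mem_erase.2 ⟨hvt₂, h'⟩)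
  have hvF₁ := hcl₁ u (hC₁ hu.2) v huv (disjoint_left.1 hd₂ hvF₂)
    (disjoint_left.1 hs₂.hFS hvF₂) (fun h' => hvT (mem_of_mem_erase h'))
  rcases hcov₁ v hvF₁ with h' | rfl
  · exact hvC₁ h'
  · exact hvT ht₁

/-- The case in which a vertex of `S` has to be set aside together with one of `common G S`. -/
theorem MaxCore.not_touch (hm : MaxCore G k x y S) (h : Minimal G col k x y z)
    (hs : Stage G k x y z S (common G S) F y z)
    (hcl : ∀ v ∈ F, ∀ u, G.Adj v u → u ∈ F ∨ u ∈ S ∨ u ∈ common G S) :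
    ¬ Touch G (common G S) F := by
  intro hT
  have hk := hs.card_lt h hT
  have hcard : #(common G S) = #S := (hm.card_common_le h hs hcl hT).antisymm hm.card_le
  obtain ⟨C, e, hr, ⟨t₁, ht₁, ht₁z, ht₁e⟩, hTF, hzF⟩ := hs.exists_exit h hcl hT
  have hyF := hs.conn.1
  have hxt₁ := hs.adj x hs.hx t₁ ht₁
  have hey : e = y ∨ G.Adj e y := hr.he.imp id fun h' => h'.2
  have hs2 : 1 < #S := by
    by_contra hlt
    have hS : S = {x} := by
      symm
      exact eq_of_subset_of_card_le (by simpa using hm.hx) (by rw [card_singleton]; omega)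
    have hcx : common G {x} = nbr G x := by ext; simp [mem_common, mem_nbr]
    have := h.two_le_card_nbr
    rw [← hcx, ← hS] at this
    omega
  obtain ⟨w, hwS, hwx⟩ := exists_mem_ne hs2 x
  have hTsub : common G S ⊆ common G (S.erase w) := common_anti (erase_subset _ _)
  have hx₁ : x ∈ S.erase w := mem_erase.2 ⟨hwx.symm, hm.hx⟩
  have hwt₁ := hs.adj w hwS t₁ ht₁
  have hS₁ : #(S.erase w) = #S - 1 := card_erase_of_mem hwS
  have hcw : common G S = common G (S.erase w) ∩ nbr G w := by
    rw [← common_insert, insert_erase hwS]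
  have hxcol : ∀ t ∈ common G (S.erase w), G.Adj x t := fun t ht => mem_common.1 ht x hx₁
  have hwy : F = {y} ∧ e = y → ∀ u ∈ F, ¬ G.Adj w u := by
    rintro ⟨hF, he⟩ u hu
    rw [hF, mem_singleton] at hu
    subst hu
    subst he
    exact h.not_adj_of_adj hwt₁ ht₁e.symm
  -- The degree bound towards the new `T`. A violating v could replace `w` in `S`, and the component
  -- of y for the exchanged set is then contradictory.
  have hbad : ∀ v, v ∉ S.erase w → v ∉ F →
      #(nbr G v ∩ (common G (S.erase w)).erase t₁) ≤ #(S.erase w) := by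
    intro v hv hvF
    by_contra hcon
    have hvS : v ∉ S := by
      intro hvS
      have hvw : v = w := by
        by_contra hvw
        exact hv (mem_erase.2 ⟨hvw, hvS⟩)
      subst hvw
      have h1 : nbr G v ∩ (common G (S.erase v)).erase t₁ ⊆ (common G S).erase t₁ := by
        rw [hcw]
        intro p hp
        rw [mem_inter, mem_erase] at hp
        exact mem_erase.2 ⟨hp.2.1, mem_inter.2 ⟨hp.2.2, hp.1⟩⟩
      have h2 := card_le_card h1
      rw [card_erase_of_mem ht₁] at h2
      omega
    have hvy : v ≠ y := fun h' => hvF (h' ▸ hyF)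
    set S' := insert v (S.erase w) with hS'
    have hS'c : #S' = #S := by rw [hS', card_insert_of_notMem hv]; omega
    have hxS' : x ∈ S' := mem_insert_of_mem hx₁
    have hyS' : y ∉ S' := by
      rw [hS', mem_insert, not_or]
      exact ⟨hvy.symm, fun h' => hm.hy (mem_of_mem_erase h')⟩
    have hcS' : common G S' = common G (S.erase w) ∩ nbr G v := common_insert v
    have hsub : nbr G v ∩ (common G (S.erase w)).erase t₁ ⊆ common G S' := by
      rw [hcS', inter_comm]
      exact inter_subset_inter_right (erase_subset _ _)
    have hcard' := card_le_card hsub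
    have hmax := hm.max_common S' hxS' hyS' (by omega) hS'c
    -- Maximality of |T| leaves no room: the common neighbours after the exchange are exactly these,
    -- so `t₁` is not among them.
    have heq := eq_of_subset_of_card_le hsub (by omega)
    have ht₁' : t₁ ∉ common G S' := by
      rw [← heq]
      simp
    have hT' : ∀ t ∈ common G S', G.Adj x t ∧ G.Adj v t := fun t ht =>
      ⟨mem_common.1 ht x hxS', mem_common.1 ht v (mem_insert_self _ _)⟩
    obtain ⟨F', hs', hcl'⟩ := h.exists_stage hxS' hyS' (by omega) (by omega)
      (.inr fun v' hv' hvy' => hm.card_inter_le hk hxS' hyS' hS'c hv' hvy')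
    obtain ⟨t₀, ht₀⟩ : (common G S').Nonempty := card_pos.1 (hs'.pos.trans hs'.card_le)
    have hcolx : ∀ {a t : V}, G.Adj x t → G.Adj a t → a ∉ common G S' := fun hxt hat h' =>
      h.not_adj_of_adj hxt hat (hT' _ h').1
    have hmemF' : ∀ a b : V, a ∈ F' → G.Adj a b → b ∉ S' → b ∉ common G S' → b ∈ F' := by
      intro a b ha hab h1 h2
      have := hcl' a ha b hab
      tauto
    -- Neither `e`, `t₁` nor `w` belongs to the exchanged complete bipartite graph, so the path from
    -- y through them stays in `F'`.
    have heF' : e ∈ F' := by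
      rcases hey with rfl | hey
      · exact hs'.conn.1
      · refine hmemF' y e hs'.conn.1 hey.symm ?_ (hcolx hxt₁ ht₁e.symm)
        rw [hS', mem_insert, not_or]
        exact ⟨fun h' => hvF (h' ▸ hr.heF),
          fun h' => disjoint_left.1 hs.hFS hr.heF (mem_of_mem_erase h')⟩
    have ht₁F' : t₁ ∈ F' := by
      refine hmemF' e t₁ heF' ht₁e.symm ?_ ht₁'
      rw [hS', mem_insert, not_or]
      refine ⟨?_, fun h' => disjoint_left.1 hs.disjST (mem_of_mem_erase h') ht₁⟩
      rintro rfl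
      exact h.not_adj_of_adj (hT' _ ht₀).1 (hT' _ ht₀).2 hxt₁
    have hwF' : w ∈ F' := by
      refine hmemF' t₁ w ht₁F' hwt₁.symm ?_ (hcolx hxt₁ hwt₁)
      rw [hS', mem_insert, not_or]
      exact ⟨fun h' => hvS (h' ▸ hwS), by simp⟩
    have htouch : Touch G (common G S') F' := by
      by_contra hnt
      have := (hs'.nbr_subset_of_not_touch h hcl' hnt).1
      rw [this, mem_singleton] at ht₁F'
      exact h.nadj (ht₁F' ▸ hxt₁)
    obtain ⟨C', e', hr', ⟨t', ht', -, hte'⟩, -, -⟩ := hs'.exists_exit h hcl' htouch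
    have hcole : col e = col e' :=
      (h.col_eq_of_adj ht₁e.symm hxt₁).trans (h.col_eq_of_adj hte'.symm (hT' t' ht').1).symm
    -- Both have the colour of x, and the residual shape of `F'` leaves one candidate of that
    -- colour. It follows that `t'` lies in the old `T` too, so `w` in `F'` is a second contact with
    -- the exchanged `T`.
    have hee' : e = e' := by
      by_cases he : e = y
      · rcases hr'.he with h' | h'
        · exact he.trans h'.symm
        · exact absurd hcole.symm (h.proper _ _ (he ▸ h'.2))
      · have hey' := hey.resolve_left he
        have he'y : e' ≠ y := fun h' => h.proper _ _ hey' (h' ▸ hcole)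
        rcases hr'.cover e heF' with h' | h' | h'
        · exact absurd (hr'.bdry y (mem_bdry.2 ⟨hr'.hq, e, h', hey'⟩) hs'.conn.1) he'y.symm
        · exact absurd h' he
        · exact h'
    subst hee'
    have ht'T : t' ∈ common G S := by
      rcases hcl e hr.heF t' hte'.symm with h' | h' | h'
      · exfalso
        rcases hcl t' h' v (hT' t' ht').2.symm with h'' | h'' | h''
        · exact hvF h''
        · exact hvS h''
        · exact h.not_adj_of_adj (hT' t' ht').1 (hT' t' ht').2 (hs.adj x hs.hx v h'')
      · exact absurd (hT' t' ht').1
          (h.not_adj_of_adj hxt₁ (hs.adj t' h' t₁ ht₁))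
      · exact h'
    rcases hr'.cover w hwF' with h' | h' | h'
    · exact hr'.hT ⟨t', ht', w, h', (hs.adj w hwS t' ht'T).symm⟩
    · exact hm.hy (h' ▸ hwS)
    · exact disjoint_left.1 hs.hFS hr.heF (h' ▸ hwS)
  -- If z is in `F`, the exception is free for `w`, which may have neighbours in `F`. Otherwise `F =
  -- {y}`, parity forbids such neighbours, and z stays exceptional.
  obtain ⟨F₁, hs₁, hd₁, hcl₁⟩ := hs.exit (S₁ := S.erase w) (t₁ := t₁) (e := e)
    (z' := if z ∈ F then w else z) h hcl (erase_subset _ _) hx₁ ht₁ hTsub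
    (by
      have := card_le_card (erase_subset_erase t₁ hTsub)
      rw [card_erase_of_mem ht₁] at this
      omega) hr.heF ht₁e hey
    (by
      intro v hv hv'
      have hvw : v = w := by
        by_contra hvw
        exact hv' (mem_erase.2 ⟨hvw, hv⟩)
      subst hvw
      split_ifs with hz
      · exact .inl rfl
      · obtain ⟨h1, h2, -⟩ := hzF.resolve_left hz
        exact .inr (hwy ⟨h1, h2⟩)) hbad
    (by intro hz; rw [if_neg hz])
  obtain ⟨C₁, e₁, hr₁⟩ := hs₁.exists_residual h
  obtain ⟨u, htu, huS, huF⟩ := hs.exists_nbr_outside h hk ht₁ ht₁z (hTF t₁ ht₁)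
  have huF₁ : u ∈ F₁ := hcl₁ t₁ hs₁.conn.1 u htu huF (fun h' => huS (mem_of_mem_erase h'))
    fun h' => h.not_adj_of_adj hxt₁ htu.symm (hxcol u (mem_of_mem_erase h'))
  have hwF₁ : w ∈ F₁ := hcl₁ t₁ hs₁.conn.1 w hwt₁.symm (disjoint_right.1 hs.hFS hwS) (by simp)
    fun h' => h.not_adj_of_adj hxt₁ hwt₁ (hxcol w (mem_of_mem_erase h'))
  obtain ⟨t₂, ht₂, ht₂₁⟩ := exists_mem_ne (by omega : 1 < #(common G S)) t₁
  -- `w` touches the new `T`, so it is not in the piece and must be `e₁`. This leaves no place in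
  -- the residual shape for the neighbour `u` of `t₁`.
  have hwe₁ : w = e₁ := by
    rcases hr₁.cover w hwF₁ with h' | h' | h'
    · exact absurd ⟨t₂, mem_erase.2 ⟨ht₂₁, hTsub ht₂⟩, w, h', (hs.adj w hwS t₂ ht₂).symm⟩ hr₁.hT
    · exact absurd (h' ▸ hwt₁) G.irrefl
    · exact h'
  rcases hr₁.cover u huF₁ with h' | h' | h'
  · have := hr₁.bdry t₁ (mem_bdry.2 ⟨hr₁.hq, u, h', htu.symm⟩) hs₁.conn.1
    rw [← hwe₁] at this
    exact G.irrefl (this ▸ hwt₁)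
  · exact G.irrefl (h' ▸ htu)
  · exact huS (h' ▸ hwe₁ ▸ hwS)

/-- From one side deg y < |S| ≤ |T| ≤ deg x, strictly because x belongs to `S` but is no neighbour
of y. Exchanging the roots gives deg x < deg y. -/
theorem Minimal.false (h : Minimal G col k x y z) : False := by
  have key : ∀ {x y : V}, Minimal G col k x y z → ∃ S, x ∈ S ∧ #S ≤ #(common G S) ∧
      nbr G y ⊆ S := by
    intro x y h
    obtain ⟨S, hm⟩ := h.exists_maxCore
    obtain ⟨F, hs, hcl⟩ := h.exists_stage hm.hx hm.hy hm.card_le_k hm.card_le (by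
      rcases hm.card_le_k.eq_or_lt with h' | h'
      · exact .inl h'
      · exact .inr fun v hv hvy => hm.card_inter_le h' hm.hx hm.hy rfl hv hvy)
    exact ⟨S, hm.hx, hm.card_le, (hs.nbr_subset_of_not_touch h hcl (hm.not_touch h hs hcl)).2⟩
  have key' : ∀ {x y : V} {S : Finset V}, ¬ G.Adj x y → x ∈ S → #S ≤ #(common G S) →
      nbr G y ⊆ S → #(nbr G y) < #S ∧ #S ≤ #(nbr G x) := by
    intro x y S hxy hx hS hy
    refine ⟨card_lt_card ⟨hy, fun h' => hxy (mem_nbr.1 (h' hx)).symm⟩,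
      hS.trans (card_le_card fun t ht => mem_nbr.2 (mem_common.1 ht x hx))⟩
  obtain ⟨S, h1, h2, h3⟩ := key h
  obtain ⟨S', h1', h2', h3'⟩ := key h.symm
  have h4 := key' h.nadj h1 h2 h3
  have h5 := key' h.symm.nadj h1' h2' h3'
  omega

end Exit

/-! ### The induction, and paths from sets with small boundary -/

section Induction

open scoped Classical

universe u
variable {V : Type u} [Fintype V] {G : SimpleGraph V} {col : V → Bool} {k : ℕ} {x y z : V}

/-- The cut condition concerns only sets avoiding both roots. A set containing x is treated through
its complement without y or, if that is empty, by deleting x. -/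
theorem Rooted.connTo (h : Rooted G col k x y z) : ConnTo G univ y := by
  refine ⟨mem_univ _, fun C _ hne hy => ?_⟩
  by_cases hx : x ∈ C
  · by_cases hD : (Cᶜ.erase y).Nonempty
    · obtain ⟨v, hv, hvy⟩ := exists_mem_ne
        (lt_of_lt_of_le one_lt_two (h.cut _ hD (by simp [hx]) (by simp))) y
      obtain ⟨hv, u, hu, huv⟩ := mem_bdry.1 hv
      have hvC : v ∈ C := by simpa [hvy] using hv
      exact ⟨v, hvC, u, mem_univ _, by simpa using mem_of_mem_erase hu, huv.symm⟩
    · obtain ⟨w, hwx, hwy, -⟩ := h.ex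
      have hmem : ∀ v, v ≠ y → v ∈ C := fun v hv => by
        by_contra hvC
        exact hD ⟨v, by simp [hv, hvC]⟩
      obtain ⟨v, hv, hvx⟩ := exists_mem_ne (lt_of_lt_of_le one_lt_two
        (h.cut (C.erase x) ⟨w, by simp [hwx, hmem w hwy]⟩ (by simp) (by simp [hy]))) x
      obtain ⟨hv, u, hu, huv⟩ := mem_bdry.1 hv
      exact ⟨u, mem_of_mem_erase hu, v, mem_univ _, fun hvC => hv (mem_erase.2 ⟨hvx, hvC⟩), huv⟩
  · obtain ⟨v, hv⟩ : (bdry G C).Nonempty := card_pos.1 (by have := h.cut C hne hx hy; omega)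
    obtain ⟨hv, u, hu, huv⟩ := mem_bdry.1 hv
    exact ⟨u, hu, v, mem_univ _, hv, huv⟩

/-- A rooted bipartite graph has `k` paths between its roots whose lengths form an arithmetic
progression with difference two. -/
theorem Rooted.rootPaths (h : Rooted G col k x y z) : RootPaths G k x y := by
  suffices H : ∀ (n : ℕ) (V : Type u) [Fintype V] (G : SimpleGraph V) (col : V → Bool) (k : ℕ)
      (x y z : V), Fintype.card V = n → Rooted G col k x y z → RootPaths G k x y from
    H _ V G col k x y z rfl h
  intro n
  induction n using Nat.strong_induction_on with
  | _ n ih =>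
    intro V _ G col k x y z hn h
    -- For k ≤ 1 at most one path is needed, and connectedness provides it.
    rcases Nat.lt_or_ge k 2 with hk | hk
    · obtain ⟨m, hm⟩ := h.connTo.linked (mem_univ x)
      refine ⟨m, fun i hi => ?_⟩
      obtain rfl : i = 0 := by omega
      exact hm
    · by_contra hno
      exact Minimal.false (col := col) (z := z)
        { toRooted := h
          two_le := hk
          ih := fun A D Z z' k' hD hS => hS.paths h.proper fun W _ G' c x y z hW hR =>
            ih _ (by omega) W G' c k' x y z hW hR
          nosol := hno }

theorem SetRooted.setPaths {A D Z : Finset V} (h : SetRooted G col k A D Z z)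
    (hcol : ∀ u v, G.Adj u v → col u ≠ col v) : SetPaths G k A D Z :=
  h.paths hcol fun _ _ _ _ _ _ _ _ => Rooted.rootPaths

/-- In a properly 2-coloured graph of minimum degree at least `k + 1`, a set with at most one
boundary vertex `b`, all of whose relevant subsets have larger boundary, contains `k` paths from
any of its vertices to `b`. -/
theorem exists_linked (hcol : ∀ u v, G.Adj u v → col u ≠ col v) (hk : 0 < k)
    (hdeg : ∀ v, k + 1 ≤ #(nbr G v)) {C : Finset V} {a b : V} (ha : a ∈ C) (hab : a ≠ b)
    (hC : bdry G C ⊆ {b}) (hmin : ∀ C' ⊆ (C.erase a).erase b, C'.Nonempty → 2 ≤ #(bdry G C')) :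
    ∃ N, 2 ≤ N ∧ ∀ i < k, Linked G (insert b C) a b (N + 2 * i) := by
  set D := (C.erase a).erase b with hD
  have haD : a ∉ D := by simp [hD]
  have hbD : b ∉ D := by simp [hD]
  have hDC : D ⊆ C := (erase_subset _ _).trans (erase_subset _ _)
  have hcl : ∀ u ∈ C, ∀ v, G.Adj u v → v ∈ insert a (insert b D) := by
    intro u hu v huv
    by_cases hvC : v ∈ C
    · simp only [hD, mem_insert, mem_erase]
      tauto
    · have := hC (mem_bdry.2 ⟨hvC, u, hu, huv⟩)
      rw [mem_singleton] at this
      simp [this]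
  have hsub : ∀ C' ⊆ D, bdry G C' ⊆ insert a (insert b D) := fun C' hC' v hv => by
    obtain ⟨-, u, hu, huv⟩ := mem_bdry.1 hv
    exact hcl u (hDC (hC' hu)) v huv
  have hbd : ∀ C' ⊆ D, bd G {a} D {b} C' = #(bdry G C') := fun C' hC' => by
    rw [bd_singletons (fun h' => haD (hC' h')) (fun h' => hbD (hC' h')) hab haD hbD,
      inter_eq_left.2 (hsub C' hC')]
  -- No exception is needed here, so the root `a` fills that place.
  have hS : SetRooted G col k {a} D {b} a := by
    refine ⟨by simpa using haD, by simpa using hbD, by simpa using hab,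
      exists_colour_singleton _ _, exists_colour_singleton _ _, fun C' hC' hne => ?_,
      fun v hv _ => ?_, ?_⟩
    · rw [hbd C' hC']
      exact hmin C' hC' hne
    · rw [hbd _ (by simpa using hv), bdry_singleton]
      exact hdeg v
    · obtain ⟨v, hv, hvb⟩ := exists_mem_ne
        (by have := hdeg a; omega : 1 < #(nbr G a)) b
      have hav := mem_nbr.1 hv
      have := hcl a ha v hav
      simp only [mem_insert, hav.ne', hvb, false_or] at this
      exact ⟨v, this, hav.ne'⟩
  obtain ⟨N, hN, hl⟩ := hS.setPaths hcol
  refine ⟨N, hN, fun i hi => ?_⟩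
  obtain ⟨a', ha', b', hb', h'⟩ := hl i hi
  rw [mem_singleton] at ha' hb'
  subst ha' hb'
  refine h'.mono ?_
  rw [insert_comm]
  exact insert_subset_insert _ (insert_subset ha hDC)

end Induction

/-! ### Maximum cuts -/

section MaxCut

open scoped Classical

universe u
variable {V : Type u} {G : SimpleGraph V} {f : V → Bool}

/-- The spanning subgraph of the edges whose ends are coloured differently. -/
def crossing (G : SimpleGraph V) (f : V → Bool) : SimpleGraph V where
  Adj u v := G.Adj u v ∧ f u ≠ f v
  symm := ⟨fun _ _ h => ⟨h.1.symm, h.2.symm⟩⟩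
  loopless := ⟨fun _ h => h.2 rfl⟩

theorem crossing_le : crossing G f ≤ G := fun _ _ h => h.1

/-- The contribution of the ordered pair `(u, v)` to the change in the number of crossing edges
when the colours on `C` are switched. -/
noncomputable def gain (G : SimpleGraph V) (f : V → Bool) (C : Finset V) (u v : V) : ℤ :=
  if G.Adj u v ∧ u ∈ C ∧ v ∉ C then (if f u = f v then 1 else -1) else 0

variable [Fintype V]

/-- Switching the colours on a set does not increase the number of crossing edges. -/
def IsMaxCut (G : SimpleGraph V) (f : V → Bool) : Prop :=
  ∀ C : Finset V, ∑ u, ∑ v, gain G f C u v ≤ 0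

theorem exists_isMaxCut (G : SimpleGraph V) : ∃ f, IsMaxCut G f := by
  set w : (V → Bool) → V → V → ℤ := fun f u v => if G.Adj u v ∧ f u ≠ f v then 1 else 0 with hw
  obtain ⟨f, hf⟩ := Finite.exists_max fun f : V → Bool => ∑ u, ∑ v, w f u v
  refine ⟨f, fun C => ?_⟩
  have h1 := hf fun v => if v ∈ C then !f v else f v
  -- Switching affects only pairs with exactly one end in `C`. Summed over ordered pairs, the two
  -- gain terms agree, so the change is twice the total gain.
  have h2 : ∀ u v, w (fun v => if v ∈ C then !f v else f v) u v =
      w f u v + (gain G f C u v + gain G f C v u) := by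
    intro u v
    simp only [hw, gain, G.adj_comm v u]
    by_cases huv : G.Adj u v <;> by_cases hu : u ∈ C <;> by_cases hv : v ∈ C <;>
      rcases Bool.eq_false_or_eq_true (f u) with hfu | hfu <;>
      rcases Bool.eq_false_or_eq_true (f v) with hfv | hfv <;> simp [huv, hu, hv, hfu, hfv]
  simp only [h2, sum_add_distrib] at h1
  rw [sum_comm (f := fun u v => gain G f C v u)] at h1
  linarith

/-- Switching a single vertex must not help, so at least half of its edges cross. -/
theorem IsMaxCut.card_nbr_le (h : IsMaxCut G f) (v : V) :
    #(nbr G v) ≤ 2 * #(nbr (crossing G f) v) := by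
  have h1 := h {v}
  rw [sum_eq_single v (fun u _ hu => sum_eq_zero fun w _ => by simp [gain, hu])
    (fun h' => absurd (mem_univ v) h')] at h1
  have h2 : ∀ u, gain G f {v} v u =
      (if G.Adj v u then 1 else 0) - 2 * (if (crossing G f).Adj v u then 1 else 0) := by
    intro u
    by_cases hvu : G.Adj v u
    · by_cases hf : f v = f u <;> simp [gain, crossing, hvu, hf, hvu.ne']
    · simp [gain, crossing, hvu]
  simp only [h2, sum_sub_distrib, ← mul_sum, sum_boole] at h1
  simp only [nbr]
  omega

/-- If no crossing edge left `C`, switching `C` would gain every edge of G that leaves it. Thus the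
crossing graph inherits connectedness. -/
theorem IsMaxCut.bdry_eq_empty (h : IsMaxCut G f) {C : Finset V}
    (hC : bdry (crossing G f) C = ∅) : bdry G C = ∅ := by
  have h0 : ∀ u v, 0 ≤ gain G f C u v := by
    intro u v
    unfold gain
    split_ifs with h1 h2
    · simp
    · have : v ∈ bdry (crossing G f) C := mem_bdry.2 ⟨h1.2.2, u, h1.2.1, h1.1, h2⟩
      simp [hC] at this
    · simp
  refine eq_empty_of_forall_notMem fun v hv => ?_
  obtain ⟨hv, u, hu, huv⟩ := mem_bdry.1 hv
  have hfuv : f u = f v := by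
    by_contra hf
    have : v ∈ bdry (crossing G f) C := mem_bdry.2 ⟨hv, u, hu, huv, hf⟩
    simp [hC] at this
  have h1 : gain G f C u v ≤ ∑ u, ∑ v, gain G f C u v :=
    (single_le_sum (fun v _ => h0 u v) (mem_univ v)).trans
      (single_le_sum (f := fun u => ∑ v, gain G f C u v)
        (fun u _ => sum_nonneg fun v _ => h0 u v) (mem_univ u))
  have h2 := h C
  have h3 : gain G f C u v = 1 := by simp [gain, huv, hu, hv, hfuv]
  omega

end MaxCut

/-! ### From path progressions to cycle lengths -/

section Cycles

open scoped Classical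

universe u
variable {V : Type u} {G : SimpleGraph V} {f : V → Bool} {l : ℕ}

/-- Length at least two ensures that the closing edge is not already on the path. -/
theorem Linked.exists_isCycle {H : SimpleGraph V} (hH : H ≤ G) {R : Finset V} {a b : V} {n : ℕ}
    (h : Linked H R a b n) (hn : 2 ≤ n) (hab : G.Adj a b) :
    ∃ (v : V) (c : G.Walk v v), c.IsCycle ∧ c.length = n + 1 := by
  obtain ⟨p, hp, rfl, -⟩ := h
  refine ⟨b, .cons hab.symm (p.mapLe hH), ?_, by simp⟩
  rw [SimpleGraph.Walk.cons_isCycle_iff]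
  have hp' : (p.mapLe hH).IsPath := hp.mapLe hH
  refine ⟨hp', fun he => ?_⟩
  have := hp'.length_eq_one_of_mem_edges (by rwa [Sym2.eq_swap] at he)
  simp at this
  omega

theorem Linked.even_iff {R : Finset V} {a b : V} {n : ℕ} (h : Linked (crossing G f) R a b n) :
    Even n ↔ f a = f b := by
  obtain ⟨p, -, rfl, -⟩ := h
  have := SimpleGraph.Coloring.even_length_iff_congr
    (SimpleGraph.Coloring.mk f fun {u v} (h : (crossing G f).Adj u v) => h.2) p
  rw [this]
  exact Bool.eq_iff_iff.symm

theorem exists_modEq {l N m : ℕ} (hl : 0 < l) (h : Even N ↔ Even m) :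
    ∃ i < l, N + 2 * i ≡ m [MOD 2 * l] := by
  -- A multiple of 2l is added so that the difference to N is a nonnegative even number; only its
  -- half modulo l matters.
  obtain ⟨j, hj⟩ : ∃ j, m + 2 * l * N = N + 2 * j := by
    have h1 : N ≤ m + 2 * l * N := by nlinarith
    have h2 : Even (m + 2 * l * N - N) := by
      rw [Nat.even_sub h1, Nat.even_add, ← h]
      simp [mul_assoc]
    obtain ⟨j, hj⟩ := h2
    exact ⟨j, by omega⟩
  refine ⟨j % l, Nat.mod_lt _ hl, ?_⟩
  have h1 : 2 * (j % l) ≡ 2 * j [MOD 2 * l] := Nat.ModEq.mul_left' 2 (Nat.mod_modEq j l)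
  have h2 : N + 2 * j ≡ m [MOD 2 * l] := by
    rw [← hj]
    simp [Nat.ModEq]
  exact (h1.add_left N).trans h2

variable [Fintype V]

theorem hasCycleLengthMod_of_linked {a b : V} {N m : ℕ} (hl : 0 < l) (hN : 2 ≤ N)
    (hab : G.Adj a b) (h : ∀ i < l, Linked (crossing G f) univ a b (N + 2 * i))
    (hm : Even m ↔ f a ≠ f b) : G.HasCycleLengthMod m (2 * l) := by
  have hpar := (h 0 hl).even_iff
  obtain ⟨i, hi, hmod⟩ := exists_modEq (N := N + 1) (m := m) hl (by
    rw [Nat.even_add_one, hm, ne_eq, ← hpar]; simp)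
  obtain ⟨v, c, hc, hlen⟩ := (h i hi).exists_isCycle crossing_le (by omega) hab
  exact ⟨v, c, hc, by rw [hlen]; convert hmod using 1; ring⟩

/-- A smallest nonempty set with at most one boundary vertex in the crossing graph plays the role of
an end block. Its smaller subsets satisfy the cut condition, and an edge from it to its boundary
vertex, or any edge at it if there is none, supplies the roots. -/
theorem exists_linked_of_adj_crossing [Nonempty V] (hl : 0 < l)
    (hdeg : ∀ v, l + 1 ≤ #(nbr (crossing G f) v)) :
    ∃ a b N, 2 ≤ N ∧ (crossing G f).Adj a b ∧
      ∀ i < l, Linked (crossing G f) univ a b (N + 2 * i) := by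
  obtain ⟨C, ⟨hne, hC⟩, hmin⟩ := exists_min_card
    (P := fun C => C.Nonempty ∧ #(bdry (crossing G f) C) ≤ 1)
    ⟨univ, univ_nonempty, by simp [bdry]⟩
  obtain ⟨a, b, ha, hab, hb⟩ : ∃ a b, a ∈ C ∧ (crossing G f).Adj a b ∧
      bdry (crossing G f) C ⊆ {b} := by
    rcases (bdry (crossing G f) C).eq_empty_or_nonempty with h0 | ⟨b, hb⟩
    · obtain ⟨a, ha⟩ := hne
      obtain ⟨b, hb⟩ : (nbr (crossing G f) a).Nonempty :=
        card_pos.1 (by have := hdeg a; omega)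
      exact ⟨a, b, ha, mem_nbr.1 hb, by simp [h0]⟩
    · obtain ⟨-, a, ha, hab⟩ := mem_bdry.1 hb
      exact ⟨a, b, ha, hab, fun c hc => by simpa using card_le_one.1 hC c hc b hb⟩
  obtain ⟨N, hN, h⟩ := exists_linked (col := f) (fun _ _ huv => And.right huv) hl hdeg ha hab.ne hb
    fun C' hC' hne' => by
      by_contra! hlt
      have h1 := hmin C' ⟨hne', by omega⟩
      have h2 := card_le_card (hC'.trans (erase_subset _ _))
      rw [card_erase_of_mem ha] at h2
      have := card_pos.2 hne
      omega
  exact ⟨a, b, N, hN, hab, fun i hi => (h i hi).mono (subset_univ _)⟩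

theorem exists_adj_of_connected (hG : G.Connected) {C : Finset V} (hne : C.Nonempty)
    (hC : ∃ w, w ∉ C) : (bdry G C).Nonempty := by
  obtain ⟨u, hu⟩ := hne
  obtain ⟨w, hw⟩ := hC
  obtain ⟨p⟩ := hG.preconnected u w
  obtain ⟨d, -, h1, h2⟩ := p.exists_boundary_dart (C : Set V) (by simpa using hu)
    (by simpa using hw)
  exact ⟨d.snd, mem_bdry.2 ⟨by simpa using h2, d.fst, by simpa using h1, d.adj⟩⟩

theorem exists_adj_of_isTwoConnected (hG : G.IsTwoConnected) {C : Finset V} {b : V}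
    (hne : C.Nonempty) (hb : b ∉ C) (hC : ∃ w, w ∉ C ∧ w ≠ b) :
    ∃ u ∈ C, ∃ v, v ∉ C ∧ v ≠ b ∧ G.Adj u v := by
  obtain ⟨u, hu⟩ := hne
  obtain ⟨w, hw, hwb⟩ := hC
  obtain ⟨p⟩ := (hG.2.2 b).preconnected ⟨u, fun h => hb (h ▸ hu)⟩ ⟨w, hwb⟩
  obtain ⟨d, -, h1, h2⟩ := p.exists_boundary_dart {v | v.1 ∈ C} hu hw
  exact ⟨d.fst, h1, d.snd, h2, d.snd.2, d.adj⟩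

/-- If the crossing graph has no small cut, any monochromatic edge serves. Otherwise take a smallest
set `C` with one boundary vertex `b`; 2-connectedness of G gives another edge leaving `C`,
necessarily monochromatic. -/
theorem exists_linked_of_monochromatic (hl : 0 < l) (hcut : IsMaxCut G f)
    (hdeg : ∀ v, l + 1 ≤ #(nbr (crossing G f) v)) (hG : G.IsTwoConnected)
    (hmono : ∃ a b, G.Adj a b ∧ f a = f b) :
    ∃ a b N, 2 ≤ N ∧ G.Adj a b ∧ f a = f b ∧
      ∀ i < l, Linked (crossing G f) univ a b (N + 2 * i) := by
  by_cases hall : ∀ C : Finset V, C.Nonempty → #C + 2 ≤ Fintype.card V →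
      2 ≤ #(bdry (crossing G f) C)
  · obtain ⟨a, b, hab, hfab⟩ := hmono
    obtain ⟨N, hN, h⟩ := exists_linked (col := f) (fun _ _ huv => And.right huv) hl hdeg
      (mem_univ a) hab.ne (by simp [bdry]) fun C' hC' hne' => hall C' hne' (by
        have h2 := card_le_card hC'
        rw [card_erase_of_mem (by simp [hab.ne']), card_erase_of_mem (mem_univ a), card_univ] at h2
        have := card_pos.2 hne'
        omega)
    exact ⟨a, b, N, hN, hab, hfab, fun i hi => (h i hi).mono (subset_univ _)⟩
  push Not at hall
  obtain ⟨C, ⟨hne, hcard, hC⟩, hmin⟩ := exists_min_card hall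
  have hpos : 0 < #C := card_pos.2 hne
  obtain ⟨b, hb⟩ : (bdry (crossing G f) C).Nonempty := by
    rw [nonempty_iff_ne_empty]
    refine fun h0 => (exists_adj_of_connected hG.2.1 hne ?_).ne_empty (hcut.bdry_eq_empty h0)
    obtain ⟨w, -, hw⟩ := exists_mem_notMem_of_card_lt_card
      (by rw [card_univ]; omega : #C < #(univ : Finset V))
    exact ⟨w, hw⟩
  have hbC : b ∉ C := (mem_bdry.1 hb).1
  have hbd : bdry (crossing G f) C ⊆ {b} := fun c hc => by
    simpa using card_le_one.1 (by omega) c hc b hb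
  obtain ⟨x, hx, y, hyC, hyb, hxy⟩ := exists_adj_of_isTwoConnected hG hne hbC (by
    obtain ⟨w, -, hw⟩ := exists_mem_notMem_of_card_lt_card
      (by rw [card_univ, card_insert_of_notMem hbC]; omega : #(insert b C) < #(univ : Finset V))
    rw [mem_insert, not_or] at hw
    exact ⟨w, hw.2, hw.1⟩)
  -- A crossing edge would put `y` on the boundary of `C`, which is only `b`.
  have hfxy : f x = f y := by
    by_contra hf
    exact hyb (by simpa using hbd (mem_bdry.2 ⟨hyC, x, hx, hxy, hf⟩))
  obtain ⟨N, hN, h⟩ := exists_linked (col := f) (fun _ _ huv => And.right huv) hl hdeg hx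
    (b := b) (fun hxb => hbC (hxb ▸ hx)) hbd fun C' hC' hne' => by
      have h2 := card_le_card (hC'.trans (erase_subset _ _))
      rw [card_erase_of_mem hx] at h2
      by_contra! hlt
      have h1 := hmin C' ⟨hne', by omega, hlt⟩
      omega
  -- The crossing graph is connected and touches `C` from outside only at `b`, so the complement of
  -- `C` is connected. A path there from `b` to `y` extends the paths from `x` to `b`.
  have hconn : ConnTo (crossing G f) Cᶜ b := by
    refine ⟨by simpa using hbC, fun C' hC' hne' hb' => ?_⟩
    have hCC' : ∀ v ∈ C', v ∉ C := fun v hv => by simpa using hC' hv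
    obtain ⟨v, hv⟩ : (bdry (crossing G f) C').Nonempty := by
      rw [nonempty_iff_ne_empty]
      exact fun h0 =>
        (exists_adj_of_connected hG.2.1 hne' ⟨b, hb'⟩).ne_empty (hcut.bdry_eq_empty h0)
    obtain ⟨hv, u, hu, huv⟩ := mem_bdry.1 hv
    refine ⟨u, hu, v, mem_compl.2 fun hvC => hb' ?_, hv, huv⟩
    have := hbd (mem_bdry.2 ⟨hCC' u hu, v, hvC, huv.symm⟩)
    rw [mem_singleton] at this
    exact this ▸ hu
  obtain ⟨m, hm⟩ := hconn.linked (mem_compl.2 hyC)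
  refine ⟨x, y, N + m, by omega, hxy, hfxy, fun i hi => ?_⟩
  refine ((h i hi).append hm.symm (fun v hv hv' => ?_) (subset_univ _) (subset_univ _)).cast
    (by ring)
  exact (mem_insert.1 hv).resolve_right (by simpa using hv')

end Cycles

end CycleLengths

theorem theorem1p7 (k : ℕ) (hk : 0 < k) (hk_even : Even k)
    {V : Type*} [Fintype V] (G : SimpleGraph V) [DecidableRel G.Adj]
    (hdeg : k + 1 ≤ G.minDegree) :
    (∀ m : ℕ, Even m → G.HasCycleLengthMod m k) ∧
      (G.IsTwoConnected → ¬ G.IsBipartite → ∀ m : ℕ, G.HasCycleLengthMod m k) := by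
  obtain ⟨l, rfl⟩ := hk_even
  rw [← two_mul] at *
  have hl : 0 < l := by omega
  obtain ⟨f, hf⟩ := CycleLengths.exists_isMaxCut G
  -- Half of 2l + 1 rounds up to l + 1.
  have hH : ∀ v, l + 1 ≤ (CycleLengths.nbr (CycleLengths.crossing G f) v).card := fun v => by
    have h1 := hf.card_nbr_le v
    have h2 := hdeg.trans (G.minDegree_le_degree v)
    have h3 : (CycleLengths.nbr G v).card = G.degree v := by
      rw [← G.card_neighborFinset_eq_degree]
      congr 1
      ext u
      simp [CycleLengths.mem_nbr]
    omega
  have heven : ∀ m : ℕ, Even m → G.HasCycleLengthMod m (2 * l) := fun m hm => by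
    have : Nonempty V := by
      by_contra hV
      rw [not_nonempty_iff] at hV
      simp at hdeg
    obtain ⟨a, b, N, hN, hab, h⟩ := CycleLengths.exists_linked_of_adj_crossing hl hH
    exact CycleLengths.hasCycleLengthMod_of_linked hl hN hab.1 h (iff_of_true hm hab.2)
  refine ⟨heven, fun hG hbip m => ?_⟩
  by_cases hm : Even m
  · exact heven m hm
  obtain ⟨a, b, N, hN, hab, hfab, h⟩ :=
    -- Without a monochromatic edge the cut would be a proper 2-colouring of G.
    CycleLengths.exists_linked_of_monochromatic hl hf hH hG (by
      by_contra! hno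
      exact hbip (by simpa using (SimpleGraph.Coloring.mk f fun {u v} h => hno u v h).colorable))
  exact CycleLengths.hasCycleLengthMod_of_linked hl hN hab h
    (iff_of_false hm (not_not_intro hfab))
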